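/- Let $k$ be a field of characteristic $p>2$, let $\mathfrak g=\mathfrak{sl}_2(k)$ with its usual basis $e,h,f$, and let $U=U(\mathfrak g)$ be its universal enveloping algebra. Let $S=\bigoplus_{n\ge 0}S^n$ be the symmetric algebra of the adjoint $\mathfrak g$-module, where $S^n$ is its $n$th symmetric power and $\mathfrak g$ acts on $S$ by derivations, and let $c=h^2+4ef\in S^2$. Let $L(1)=k^2$ be the natural $\mathfrak g$-module, with basis $x,y$ such that $h\cdot x=x$ and $h\cdot y=-y$, and let $S^m(L(1))$ be its $m$th symmetric power. Let $n\ge 2$, and let $\phi:S^n\to S^{2n}(L(1))$ be the degree $n$ part of the algebra homomorphism $S\to S(L(1))$ with $e\mapsto -\tfrac12x^2$, $h\mapsto xy$, $f\mapsto\tfrac12y^2$; that is, $\phi$ vanishes on $cS^{n-2}$ and, for $0\le i\le n$, $$\phi(e^ih^{n-i})=(-2)^{-i}x^{n+i}y^{n-i},\qquad \phi(f^ih^{n-i})=2^{-i}x^{n-i}y^{n+i}.$$ Then $$0\to S^{n-2}\xrightarrow{\ \times c\ }S^n\xrightarrow{\ \phi\ }S^{2n}(L(1))\to 0$$ is a short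 exact sequence of $U$-modules, and the third connecting homomorphism $$\partial:\operatorname{Ext}^2_U(k,S^{2n}(L(1)))\to\operatorname{Ext}^3_U(k,S^{n-2})$$ of the long exact sequence obtained by applying $\operatorname{Hom}_U(k,-)$ to it, where $k$ is the trivial $U$-module, satisfies: if $n\ne p-1$ then $\partial=0$; if $n=p-1$ then the image of $\partial$ is a $k$-vector space of dimension one. -/

import Mathlib

open CategoryTheory CategoryTheory.Abelian

noncomputable section

namespace SlTwoExt

universe u v

section SymmetricPowers

variable {k : Type u} [Field k] {M : Type v} [AddCommGroup M] [Module k M]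

variable (k M) in
/-- The symmetric algebra `S(M)` of `M`. This is Mathlib's symmetric algebra, under a name of its own
so that its algebra structure is the only one that instance search finds. -/
def SymAlg : Type (max u v) := SymmetricAlgebra k M

namespace SymAlg

instance : CommRing (SymAlg k M) := inferInstanceAs (CommRing (SymmetricAlgebra k M))

instance : Algebra k (SymAlg k M) := inferInstanceAs (Algebra k (SymmetricAlgebra k M))

variable (k M) in
/-- The canonical linear map `M → S(M)`. -/
def ι : M →ₗ[k] SymAlg k M := SymmetricAlgebra.ι k M

/-- The algebra homomorphism on `S(M)` with given linear restriction to `M`. -/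
def lift {A : Type*} [CommRing A] [Algebra k A] (f : M →ₗ[k] A) : SymAlg k M →ₐ[k] A :=
  SymmetricAlgebra.lift f

@[simp]
theorem lift_ι {A : Type*} [CommRing A] [Algebra k A] (f : M →ₗ[k] A) (m : M) :
    lift f (ι k M m) = f m :=
  SymmetricAlgebra.lift_ι_apply f m

theorem induction {motive : SymAlg k M → Prop}
    (algebraMap : ∀ r, motive (Algebra.algebraMap k (SymAlg k M) r)) (ι : ∀ x, motive (ι k M x))
    (mul : ∀ a b, motive a → motive b → motive (a * b))
    (add : ∀ a b, motive a → motive b → motive (a + b))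
    (a : SymAlg k M) : motive a :=
  SymmetricAlgebra.induction k M (motive := motive) algebraMap ι mul add a

end SymAlg

/-- The algebra homomorphism `s ↦ s + ε D(s)` from the symmetric algebra `S(M)` to the dual numbers
over it, where `D` is the derivation of `S(M)` extending the endomorphism `f` of `M`. -/
def symDualHom (f : M →ₗ[k] M) :
    SymAlg k M →ₐ[k] TrivSqZeroExt (SymAlg k M) (SymAlg k M) :=
  SymAlg.lift
    ((TrivSqZeroExt.inlAlgHom k (SymAlg k M) (SymAlg k M)).toLinearMap ∘ₗ
        SymAlg.ι k M +
      (TrivSqZeroExt.inrHom (SymAlg k M) (SymAlg k M)).restrictScalars k ∘ₗ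
        SymAlg.ι k M ∘ₗ f)

theorem fst_symDualHom (f : M →ₗ[k] M) (s : SymAlg k M) :
    (symDualHom f s).fst = s := by
  induction s using SymAlg.induction with
  | algebraMap r => rw [AlgHom.commutes, TrivSqZeroExt.algebraMap_eq_inl', TrivSqZeroExt.fst_inl]
  | ι m => simp [symDualHom]
  | mul a b ha hb => rw [map_mul, TrivSqZeroExt.fst_mul, ha, hb]
  | add a b ha hb => rw [map_add, TrivSqZeroExt.fst_add, ha, hb]

/-- The derivation of the symmetric algebra `S(M)` that extends the endomorphism `f` of `M`. -/
def symDer (f : M →ₗ[k] M) : Derivation k (SymAlg k M) (SymAlg k M) :=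
  Derivation.mk'
    ((TrivSqZeroExt.sndHom (SymAlg k M) (SymAlg k M)).restrictScalars k ∘ₗ
      (symDualHom f).toLinearMap) (by
    intro a b
    simp [fst_symDualHom, TrivSqZeroExt.snd_mul, mul_comm b])

@[simp]
theorem symDer_ι (f : M →ₗ[k] M) (m : M) :
    symDer f (SymAlg.ι k M m) = SymAlg.ι k M (f m) := by
  simp [symDer, symDualHom]

/-- Two derivations along an algebra homomorphism that agree on `M` agree on `S(M)`. -/
theorem sym_leibniz_ext {A : Type*} [CommRing A] [Algebra k A] (φ : SymAlg k M →ₐ[k] A)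
    (D D' : SymAlg k M →ₗ[k] A)
    (hD : ∀ a b, D (a * b) = φ a * D b + φ b * D a)
    (hD' : ∀ a b, D' (a * b) = φ a * D' b + φ b * D' a)
    (h : ∀ m, D (SymAlg.ι k M m) = D' (SymAlg.ι k M m)) : D = D' := by
  have h1 : ∀ E : SymAlg k M →ₗ[k] A,
      (∀ a b, E (a * b) = φ a * E b + φ b * E a) → E 1 = 0 := by
    intro E hE
    have := hE 1 1
    simpa using this
  ext s
  induction s using SymAlg.induction with
  | algebraMap r => simp [Algebra.algebraMap_eq_smul_one, h1 D hD, h1 D' hD']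
  | ι m => exact h m
  | mul a b ha hb => rw [hD, hD', ha, hb]
  | add a b ha hb => rw [map_add, map_add, ha, hb]

variable {L : Type v} [LieRing L] [LieAlgebra k L] [LieRingModule L M] [LieModule k L M]

/-- A Lie algebra acts on the symmetric algebra of a representation by derivations. -/
instance symLieRingModule : LieRingModule L (SymAlg k M) where
  bracket x s := symDer (LieModule.toEnd k L M x) s
  add_lie x y s := by
    refine DFunLike.congr_fun (sym_leibniz_ext (AlgHom.id k _)
      (symDer (LieModule.toEnd k L M (x + y))).toLinearMap
      (symDer (LieModule.toEnd k L M x) + symDer (LieModule.toEnd k L M y)).toLinearMap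
      (fun a b => by simp) (fun a b => by simp; ring) (fun m => by simp)) s
  lie_add x s t := map_add _ _ _
  leibniz_lie x y s := by
    have h := DFunLike.congr_fun (sym_leibniz_ext (AlgHom.id k _)
      (symDer (LieModule.toEnd k L M ⁅x, y⁆)).toLinearMap
      ((symDer (LieModule.toEnd k L M x)).toLinearMap ∘ₗ
          (symDer (LieModule.toEnd k L M y)).toLinearMap -
        (symDer (LieModule.toEnd k L M y)).toLinearMap ∘ₗ
          (symDer (LieModule.toEnd k L M x)).toLinearMap)
      (fun a b => by simp) (fun a b => by simp; ring) (fun m => by simp)) s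
    have h' : symDer (LieModule.toEnd k L M ⁅x, y⁆) s =
        symDer (LieModule.toEnd k L M x) (symDer (LieModule.toEnd k L M y) s) -
        symDer (LieModule.toEnd k L M y) (symDer (LieModule.toEnd k L M x) s) := h
    rw [h', sub_add_cancel]

theorem sym_lie_def (x : L) (s : SymAlg k M) :
    ⁅x, s⁆ = symDer (LieModule.toEnd k L M x) s := rfl

@[simp]
theorem sym_lie_ι (x : L) (m : M) :
    ⁅x, SymAlg.ι k M m⁆ = SymAlg.ι k M ⁅x, m⁆ := by
  simp [sym_lie_def]

theorem sym_lie_mul (x : L) (s t : SymAlg k M) :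
    ⁅x, s * t⁆ = s * ⁅x, t⁆ + t * ⁅x, s⁆ := by
  simp [sym_lie_def]

instance symLieModule : LieModule k L (SymAlg k M) where
  smul_lie r x s := by
    refine DFunLike.congr_fun (sym_leibniz_ext (AlgHom.id k _)
      (symDer (LieModule.toEnd k L M (r • x))).toLinearMap
      (r • symDer (LieModule.toEnd k L M x)).toLinearMap
      (fun a b => by simp) (fun a b => by simp [smul_add]) (fun m => by simp)) s
  lie_smul r x s := (symDer (LieModule.toEnd k L M x)).map_smul r s

theorem sym_lie_smul (x : L) (r : k) (s : SymAlg k M) : ⁅x, r • s⁆ = r • ⁅x, s⁆ :=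
  lie_smul r x s

variable (k M L) in
/-- The `n`-th symmetric power of a representation `M`, as the degree `n` part of `S(M)`: the span
of the products of `n` elements of `M`. -/
def symPow (n : ℕ) : LieSubmodule k L (SymAlg k M) where
  __ := (LinearMap.range (SymAlg.ι k M)) ^ n
  lie_mem := by
    intro x s hs
    change ⁅x, s⁆ ∈ (LinearMap.range (SymAlg.ι k M)) ^ n
    replace hs : s ∈ (LinearMap.range (SymAlg.ι k M)) ^ n := hs
    induction hs using Submodule.pow_induction_on_left' with
    | algebraMap r =>
      rw [sym_lie_def, Derivation.map_algebraMap]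
      exact Submodule.zero_mem _
    | add a b i ha hb iha ihb => rw [lie_add]; exact Submodule.add_mem _ iha ihb
    | mem_mul m hm i a ha iha =>
      obtain ⟨m, rfl⟩ := hm
      rw [sym_lie_mul, sym_lie_ι, mul_comm a, pow_succ']
      exact Submodule.add_mem _ (Submodule.mul_mem_mul ⟨_, rfl⟩ iha)
        (Submodule.mul_mem_mul ⟨_, rfl⟩ ha)

theorem mem_symPow {n : ℕ} {s : SymAlg k M} :
    s ∈ symPow k M L n ↔ s ∈ (LinearMap.range (SymAlg.ι k M)) ^ n := Iff.rfl

end SymmetricPowers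

section EnvelopingAlgebra

variable (k : Type u) [Field k] (L : Type v) [LieRing L] [LieAlgebra k L]

/-- A representation of `L`, as a module over the universal enveloping algebra of `L`. -/
def uModule (M : Type v) [AddCommGroup M] [Module k M] [LieRingModule L M] [LieModule k L M] :
    ModuleCat.{v} (UniversalEnvelopingAlgebra k L) :=
  letI : Module (UniversalEnvelopingAlgebra k L) M :=
    Module.compHom M (UniversalEnvelopingAlgebra.lift k (LieModule.toEnd k L M)).toRingHom
  ModuleCat.of (UniversalEnvelopingAlgebra k L) M

variable {k L}
variable {M N : Type v} [AddCommGroup M] [Module k M] [LieRingModule L M] [LieModule k L M]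
  [AddCommGroup N] [Module k N] [LieRingModule L N] [LieModule k L N]

theorem lift_comm (f : M →ₗ⁅k,L⁆ N) (a : UniversalEnvelopingAlgebra k L) (m : M) :
    f (UniversalEnvelopingAlgebra.lift k (LieModule.toEnd k L M) a m) =
      UniversalEnvelopingAlgebra.lift k (LieModule.toEnd k L N) a (f m) := by
  let T : Subalgebra k (UniversalEnvelopingAlgebra k L) :=
    { carrier := {a | ∀ m : M, f (UniversalEnvelopingAlgebra.lift k (LieModule.toEnd k L M) a m) =
        UniversalEnvelopingAlgebra.lift k (LieModule.toEnd k L N) a (f m)}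
      mul_mem' := fun {a b} ha hb m => by
        simp only [Set.mem_ofPred_eq] at ha hb
        simp [ha, hb]
      add_mem' := fun {a b} ha hb m => by
        simp only [Set.mem_ofPred_eq] at ha hb
        simp [ha, hb]
      algebraMap_mem' := fun r m => by simp [Module.algebraMap_end_apply] }
  let _ : LieRing T := LieRing.ofAssociativeRing
  let _ : LieAlgebra k T := LieAlgebra.ofAssociativeAlgebra
  let _ : LieRing (UniversalEnvelopingAlgebra k L) := LieRing.ofAssociativeRing
  let _ : LieAlgebra k (UniversalEnvelopingAlgebra k L) := LieAlgebra.ofAssociativeAlgebra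
  let g : L →ₗ⁅k⁆ T :=
    { toFun := fun x => ⟨UniversalEnvelopingAlgebra.ι k x, fun m => by
        simp only [UniversalEnvelopingAlgebra.lift_ι_apply, LieModule.toEnd_apply_apply]
        exact f.map_lie x m⟩
      map_add' := fun x y => Subtype.ext (map_add _ x y)
      map_smul' := fun r x => Subtype.ext (map_smul _ r x)
      map_lie' := fun {x y} => Subtype.ext (LieHom.map_lie _ x y) }
  have h : T.val.comp (UniversalEnvelopingAlgebra.lift k g) = AlgHom.id k _ := by
    apply (UniversalEnvelopingAlgebra.lift k).symm.injective
    apply LieHom.ext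
    intro x
    change T.val (UniversalEnvelopingAlgebra.lift k g (UniversalEnvelopingAlgebra.ι k x)) =
      UniversalEnvelopingAlgebra.ι k x
    rw [UniversalEnvelopingAlgebra.lift_ι_apply]
    rfl
  have h2 := (UniversalEnvelopingAlgebra.lift k g a).2
  have h3 : (UniversalEnvelopingAlgebra.lift k g a : UniversalEnvelopingAlgebra k L) = a :=
    DFunLike.congr_fun h a
  rw [h3] at h2
  exact h2 m

/-- A homomorphism of representations, as a homomorphism of modules over the universal enveloping
algebra. -/
def uMap (f : M →ₗ⁅k,L⁆ N) : uModule k L M ⟶ uModule k L N :=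
  letI : Module (UniversalEnvelopingAlgebra k L) M :=
    Module.compHom M (UniversalEnvelopingAlgebra.lift k (LieModule.toEnd k L M)).toRingHom
  letI : Module (UniversalEnvelopingAlgebra k L) N :=
    Module.compHom N (UniversalEnvelopingAlgebra.lift k (LieModule.toEnd k L N)).toRingHom
  ModuleCat.ofHom
    { toFun := f
      map_add' := map_add f
      map_smul' := fun a m => lift_comm f a m }

end EnvelopingAlgebra

section SlTwo

variable (k : Type u) [Field k]

/-- The Lie algebra `𝔰𝔩₂(k)` of traceless `2 × 2` matrices. -/
abbrev slTwo : Type u := LieAlgebra.SpecialLinear.sl (Fin 2) k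

/-- The basis element `e` of `𝔰𝔩₂(k)`. -/
def slE : slTwo k := ⟨!![0, 1; 0, 0], by simp [LieAlgebra.SpecialLinear.sl, Matrix.trace]⟩

/-- The basis element `h` of `𝔰𝔩₂(k)`. -/
def slH : slTwo k := ⟨!![1, 0; 0, -1], by simp [LieAlgebra.SpecialLinear.sl, Matrix.trace]⟩

/-- The basis element `f` of `𝔰𝔩₂(k)`. -/
def slF : slTwo k := ⟨!![0, 0; 1, 0], by simp [LieAlgebra.SpecialLinear.sl, Matrix.trace]⟩

/-- The natural representation `L(1) = k²` of `𝔰𝔩₂(k)`. -/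
def NatRep : Type u := Fin 2 → k

instance : AddCommGroup (NatRep k) := inferInstanceAs (AddCommGroup (Fin 2 → k))

instance : Module k (NatRep k) := inferInstanceAs (Module k (Fin 2 → k))

/-- Matrices act on column vectors. -/
instance : LieRingModule (slTwo k) (NatRep k) :=
  inferInstanceAs (LieRingModule (LieAlgebra.SpecialLinear.sl (Fin 2) k) (Fin 2 → k))

instance : LieModule k (slTwo k) (NatRep k) :=
  inferInstanceAs (LieModule k (LieAlgebra.SpecialLinear.sl (Fin 2) k) (Fin 2 → k))

/-- The basis vector `x` of `L(1)`, of weight `1`. -/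
def vecX : NatRep k := (![1, 0] : Fin 2 → k)

/-- The basis vector `y` of `L(1)`, of weight `-1`. -/
def vecY : NatRep k := (![0, 1] : Fin 2 → k)

/-- The symmetric algebra `S` of the adjoint representation. -/
abbrev SAd : Type u := SymAlg k (slTwo k)

/-- The symmetric algebra of the natural representation `L(1)`. -/
abbrev SNat : Type u := SymAlg k (NatRep k)

/-- The invariant `c = h² + 4ef` of `S`. -/
def casimir : SAd k :=
  SymAlg.ι k _ (slH k) ^ 2 +
    4 * (SymAlg.ι k _ (slE k) * SymAlg.ι k _ (slF k))

/-- The basis vector `x` of `L(1)`, as an element of `S(L(1))`. -/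
def natX : SNat k := SymAlg.ι k (NatRep k) (vecX k)

/-- The basis vector `y` of `L(1)`, as an element of `S(L(1))`. -/
def natY : SNat k := SymAlg.ι k (NatRep k) (vecY k)

/-- The linear map `𝔰𝔩₂(k) → S²(L(1))` with `e ↦ -x²/2`, `h ↦ xy`, `f ↦ y²/2`. -/
def phiLin : slTwo k →ₗ[k] SNat k where
  toFun A := (-(A.1 0 1) / 2) • natX k ^ 2 + A.1 0 0 • (natX k * natY k) +
    (A.1 1 0 / 2) • natY k ^ 2
  map_add' A B := by
    have h : ∀ i j, (A + B).1 i j = A.1 i j + B.1 i j := fun _ _ => rfl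
    rw [h, h, h, neg_add, add_div, add_div, add_smul, add_smul, add_smul]
    abel
  map_smul' r A := by
    have h : ∀ i j, (r • A).1 i j = r * A.1 i j := fun _ _ => rfl
    rw [h, h, h, RingHom.id_apply, smul_add, smul_add, smul_smul, smul_smul, smul_smul,
      mul_div_assoc, neg_mul_eq_mul_neg, mul_div_assoc]

/-- The algebra homomorphism `S → S(L(1))` with `e ↦ -x²/2`, `h ↦ xy`, `f ↦ y²/2`. -/
def phiAlg : SAd k →ₐ[k] SNat k := SymAlg.lift (phiLin k)

variable {k}

theorem two_ne_zero_of_charP (p : ℕ) [CharP k p] (hp : 2 < p) : (2 : k) ≠ 0 := by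
  intro h
  have h' : ((2 : ℕ) : k) = 0 := by exact_mod_cast h
  rw [CharP.cast_eq_zero_iff k p] at h'
  exact absurd (Nat.le_of_dvd (by norm_num) h') (by omega)

theorem slTwo_trace (A : slTwo k) : A.1 1 1 = -A.1 0 0 := by
  have h : Matrix.trace A.1 = 0 := A.2
  rw [Matrix.trace_fin_two] at h
  linear_combination h

theorem slTwo_lie_apply (A B : slTwo k) (i j : Fin 2) :
    ⁅A, B⁆.1 i j = A.1 i 0 * B.1 0 j + A.1 i 1 * B.1 1 j -
      (B.1 i 0 * A.1 0 j + B.1 i 1 * A.1 1 j) := by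
  rw [LieAlgebra.SpecialLinear.sl_bracket, Matrix.sub_apply, Matrix.mul_apply, Matrix.mul_apply,
    Fin.sum_univ_two, Fin.sum_univ_two]

theorem slTwo_eq (A : slTwo k) :
    A = A.1 0 1 • slE k + A.1 0 0 • slH k + A.1 1 0 • slF k := by
  apply Subtype.ext
  change A.1 = A.1 0 1 • (slE k).1 + A.1 0 0 • (slH k).1 + A.1 1 0 • (slF k).1
  ext i j
  fin_cases i <;> fin_cases j <;> simp [slE, slH, slF, slTwo_trace]

theorem lie_casimir (A : slTwo k) : ⁅A, casimir k⁆ = 0 := by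
  have he : ⁅A, slE k⁆ = (2 * A.1 0 0) • slE k - A.1 1 0 • slH k := by
    rw [slTwo_eq ⁅A, slE k⁆]
    simp only [slTwo_lie_apply, slTwo_trace]
    simp [slE]
    module
  have hh : ⁅A, slH k⁆ = (2 * A.1 1 0) • slF k - (2 * A.1 0 1) • slE k := by
    rw [slTwo_eq ⁅A, slH k⁆]
    simp only [slTwo_lie_apply, slTwo_trace]
    simp [slH]
    module
  have hf : ⁅A, slF k⁆ = A.1 0 1 • slH k - (2 * A.1 0 0) • slF k := by
    rw [slTwo_eq ⁅A, slF k⁆]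
    simp only [slTwo_lie_apply, slTwo_trace]
    simp [slF]
    module
  have h4 : (4 : SAd k) = algebraMap k (SAd k) 4 := (map_ofNat _ 4).symm
  rw [casimir, lie_add, pow_two, sym_lie_mul, h4, ← Algebra.smul_def, sym_lie_smul, sym_lie_mul,
    sym_lie_ι, sym_lie_ι, sym_lie_ι, he, hh, hf]
  simp only [map_sub, map_smul, Algebra.smul_def, map_mul, map_ofNat]
  ring

theorem casimir_mem : casimir k ∈ symPow k (slTwo k) (slTwo k) 2 := by
  rw [mem_symPow, casimir]
  have h4 : (4 : SAd k) = algebraMap k (SAd k) 4 := (map_ofNat _ 4).symm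
  refine Submodule.add_mem _ (Submodule.pow_mem_pow _ (LinearMap.mem_range_self _ _) 2) ?_
  rw [h4, ← Algebra.smul_def, pow_two]
  exact Submodule.smul_mem _ _ (Submodule.mul_mem_mul (LinearMap.mem_range_self _ _)
    (LinearMap.mem_range_self _ _))

theorem phiAlg_mem {n : ℕ} {s : SAd k} (hs : s ∈ symPow k (slTwo k) (slTwo k) n) :
    phiAlg k s ∈ symPow k (NatRep k) (slTwo k) (2 * n) := by
  rw [mem_symPow] at hs ⊢
  have h : (LinearMap.range (SymAlg.ι k (slTwo k))).map (phiAlg k).toLinearMap ≤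
      (LinearMap.range (SymAlg.ι k (NatRep k))) ^ 2 := by
    rintro _ ⟨_, ⟨A, rfl⟩, rfl⟩
    change phiAlg k (SymAlg.ι k (slTwo k) A) ∈ _
    rw [phiAlg, SymAlg.lift_ι, phiLin, LinearMap.coe_mk, AddHom.coe_mk, pow_two,
      pow_two, pow_two]
    refine Submodule.add_mem _ (Submodule.add_mem _ ?_ ?_) ?_ <;>
    exact Submodule.smul_mem _ _ (Submodule.mul_mem_mul ⟨_, rfl⟩ ⟨_, rfl⟩)
  have h2 := Submodule.mem_map_of_mem (f := (phiAlg k).toLinearMap) hs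
  rw [Submodule.map_pow] at h2
  rw [pow_mul]
  exact pow_le_pow_left' h n h2

theorem phiAlg_lie (h2 : (2 : k) ≠ 0) (A : slTwo k) (s : SAd k) :
    phiAlg k ⁅A, s⁆ = ⁅A, phiAlg k s⁆ := by
  refine DFunLike.congr_fun (sym_leibniz_ext (phiAlg k)
    ((phiAlg k).toLinearMap ∘ₗ LieModule.toEnd k (slTwo k) (SAd k) A)
    (LieModule.toEnd k (slTwo k) (SNat k) A ∘ₗ (phiAlg k).toLinearMap)
    (fun a b => by simp [sym_lie_mul]) (fun a b => by simp [sym_lie_mul]) (fun B => ?_)) s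
  change phiAlg k ⁅A, SymAlg.ι k (slTwo k) B⁆ =
    ⁅A, phiAlg k (SymAlg.ι k (slTwo k) B)⁆
  have hx : ⁅A, natX k⁆ = A.1 0 0 • natX k + A.1 1 0 • natY k := by
    rw [natX, natY, sym_lie_ι, ← map_smul, ← map_smul, ← map_add]
    congr 1
    change A.1.mulVec ![1, 0] =
      A.1 0 0 • (![1, 0] : Fin 2 → k) + A.1 1 0 • (![0, 1] : Fin 2 → k)
    ext i
    rw [Pi.add_apply, Pi.smul_apply, Pi.smul_apply]
    fin_cases i <;> simp [Matrix.mulVec, dotProduct]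
  have hy : ⁅A, natY k⁆ = A.1 0 1 • natX k - A.1 0 0 • natY k := by
    rw [natX, natY, sym_lie_ι, ← map_smul, ← map_smul, ← map_sub]
    congr 1
    change A.1.mulVec ![0, 1] =
      A.1 0 1 • (![1, 0] : Fin 2 → k) - A.1 0 0 • (![0, 1] : Fin 2 → k)
    ext i
    rw [Pi.sub_apply, Pi.smul_apply, Pi.smul_apply]
    fin_cases i <;> simp [Matrix.mulVec, dotProduct, slTwo_trace]
  have hhalf : (2 : SNat k) * algebraMap k (SNat k) 2⁻¹ = 1 := by
    rw [← map_ofNat (algebraMap k (SNat k)) 2, ← map_mul, mul_inv_cancel₀ h2, map_one]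
  rw [sym_lie_ι, phiAlg, SymAlg.lift_ι, SymAlg.lift_ι, phiLin,
    LinearMap.coe_mk, AddHom.coe_mk, slTwo_lie_apply, slTwo_lie_apply, slTwo_lie_apply, lie_add,
    lie_add, sym_lie_smul, sym_lie_smul, sym_lie_smul, pow_two, pow_two, sym_lie_mul, sym_lie_mul, sym_lie_mul,
    hx, hy]
  simp only [slTwo_trace, Algebra.smul_def, div_eq_mul_inv, map_mul, map_add, map_sub, map_neg]
  set t := algebraMap k (SNat k) 2⁻¹
  set a := algebraMap k (SNat k) (A.1 0 0)
  set b := algebraMap k (SNat k) (A.1 0 1)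
  set c := algebraMap k (SNat k) (A.1 1 0)
  set a' := algebraMap k (SNat k) (B.1 0 0)
  set b' := algebraMap k (SNat k) (B.1 0 1)
  set c' := algebraMap k (SNat k) (B.1 1 0)
  linear_combination (a' * b * natX k ^ 2 + a' * c * natY k ^ 2 +
    (b' * c - b * c') * natX k * natY k) * hhalf

theorem phiAlg_casimir (h2 : (2 : k) ≠ 0) : phiAlg k (casimir k) = 0 := by
  have hhalf : (2 : SNat k) * algebraMap k (SNat k) 2⁻¹ = 1 := by
    rw [← map_ofNat (algebraMap k (SNat k)) 2, ← map_mul, mul_inv_cancel₀ h2, map_one]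
  have he : phiAlg k (SymAlg.ι k _ (slE k)) =
      -(algebraMap k (SNat k) 2⁻¹ * natX k ^ 2) := by
    simp [phiAlg, phiLin, slE, Algebra.smul_def, div_eq_mul_inv]
  have hh : phiAlg k (SymAlg.ι k _ (slH k)) = natX k * natY k := by
    simp [phiAlg, phiLin, slH]
  have hf : phiAlg k (SymAlg.ι k _ (slF k)) =
      algebraMap k (SNat k) 2⁻¹ * natY k ^ 2 := by
    simp [phiAlg, phiLin, slF, Algebra.smul_def, div_eq_mul_inv]
  rw [casimir, map_add, map_pow, map_mul, map_mul, map_ofNat, he, hh, hf]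
  linear_combination (-natX k ^ 2 * natY k ^ 2 *
    (1 + 2 * algebraMap k (SNat k) 2⁻¹)) * hhalf

/-- Multiplication by `c`, as a homomorphism of representations `Sⁿ⁻² → Sⁿ`. -/
def mulCasimir (n : ℕ) (hn : 2 ≤ n) :
    symPow k (slTwo k) (slTwo k) (n - 2) →ₗ⁅k,slTwo k⁆ symPow k (slTwo k) (slTwo k) n where
  toFun s := ⟨casimir k * s.1, by
    have h := Submodule.mul_mem_mul (mem_symPow.1 (casimir_mem (k := k))) (mem_symPow.1 s.2)
    rwa [← pow_add, Nat.add_sub_cancel' hn] at h⟩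
  map_add' _ _ := Subtype.ext (mul_add _ _ _)
  map_smul' _ _ := Subtype.ext (mul_smul_comm _ _ _)
  map_lie' {A s} := Subtype.ext (by
    change casimir k * ⁅A, s.1⁆ = ⁅A, casimir k * s.1⁆
    rw [sym_lie_mul, lie_casimir, mul_zero, add_zero])

/-- The homomorphism of representations `φ : Sⁿ → S²ⁿ(L(1))`. It kills `c Sⁿ⁻²`, and
`φ(eⁱhⁿ⁻ⁱ) = (-2)⁻ⁱ xⁿ⁺ⁱyⁿ⁻ⁱ`, `φ(hⁿ) = xⁿyⁿ`, `φ(fⁱhⁿ⁻ⁱ) = 2⁻ⁱ xⁿ⁻ⁱyⁿ⁺ⁱ`. -/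
def phi (h2 : (2 : k) ≠ 0) (n : ℕ) :
    symPow k (slTwo k) (slTwo k) n →ₗ⁅k,slTwo k⁆ symPow k (NatRep k) (slTwo k) (2 * n) where
  toFun s := ⟨phiAlg k s.1, phiAlg_mem s.2⟩
  map_add' _ _ := Subtype.ext (map_add _ _ _)
  map_smul' _ _ := Subtype.ext (map_smul _ _ _)
  map_lie' {A s} := Subtype.ext (phiAlg_lie h2 A s.1)

/-- The sequence `Sⁿ⁻² → Sⁿ → S²ⁿ(L(1))` of `U(𝔰𝔩₂(k))`-modules, with maps `× c` and `φ`. -/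
def sesSym (h2 : (2 : k) ≠ 0) (n : ℕ) (hn : 2 ≤ n) :
    ShortComplex (ModuleCat.{u} (UniversalEnvelopingAlgebra k (slTwo k))) :=
  ShortComplex.mk (uMap (mulCasimir n hn)) (uMap (phi h2 n)) (by
    ext s
    apply Subtype.ext
    change phiAlg k (casimir k * s.1) = 0
    rw [map_mul, phiAlg_casimir h2, zero_mul])

variable (k) in
/-- The trivial `U(𝔰𝔩₂(k))`-module `k`. -/
def trivialModule : ModuleCat.{u} (UniversalEnvelopingAlgebra k (slTwo k)) :=
  uModule k (slTwo k) (TrivialLieModule k (slTwo k) k)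

end SlTwo

/-- The connecting homomorphism `Extⁱ(X, S₃) → Extⁱ⁺¹(X, S₁)` of the long exact sequence obtained by
applying `Hom(X, -)` to a short exact sequence `0 → S₁ → S₂ → S₃ → 0` of modules over a
`k`-algebra `A`. -/
def connectingHom (k : Type u) [Field k] {A : Type u} [Ring A] [Algebra k A]
    (X : ModuleCat.{u} A) {S : ShortComplex (ModuleCat.{u} A)} (hS : S.ShortExact) (i : ℕ) :
    Ext.{u} X S.X₃ i →ₗ[k] Ext.{u} X S.X₁ (i + 1) :=
  hS.extClass.postcompOfLinear k X rfl

end SlTwoExt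

end

/-! The Chevalley–Eilenberg (Koszul) resolution 0 → U → U³ → U³ → U → k → 0 identifies Ext³(k, M)
with the coinvariants M/𝔤M, naturally in M. This is the content of `extThree_surjective`,
`extThree_eq_zero_iff` and `extThree_comp`. By the long exact sequence the image of ∂ is the kernel
of multiplication by c on Ext³, that is {s ∈ Sⁿ⁻² : cs ∈ 𝔤Sⁿ} modulo 𝔤Sⁿ⁻²
(`extThree_mem_range_connectingHom_iff`), so the theorem becomes a question about coinvariants of
symmetric powers.

Put m = n - 2. Dually, c is injective on coinvariants as soon as every functional on Sᵐ that kills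
𝔤Sᵐ has the form s ↦ ν(cs) with ν killing 𝔤Sᵐ⁺². On the monomials eⁱhˡfʲ such functionals are the
solutions of a small system of recurrences, `IsInv`. If m + 3 ≠ 0 in k, a rescaled Laplacian dual to
c supplies ν, after division by m + 3 (`IsInv.exists_lift_of_ne_zero`). If m + 3 = 0 in k but m + 3
≠ p, the recurrences force (j + 1) μ(i, l, j) = 0 throughout, and then the solution of ν(c·) = μ by
descent on l is invariant (`IsInv.exists_lift_of_eq_zero`). This gives
`mem_brackets_of_casimir_mul_mem`, hence ∂ = 0 for n ≠ p - 1.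

In the remaining case m = p - 3 the coinvariants of Sᵖ⁻³ are the line spanned by hᵖ⁻³
(`symPow_le_brackets_sup_span`, `mon_notMem_brackets`), and c annihilates that line because chᵖ⁻³ =
[e, hᵖ⁻²f] (`casimir_mul_mon_mem_brackets`). So the image of ∂ is the whole line.

Exactness of the resolution rests on three cancellation facts for right multiplication by e, h + r
and f (`eq_zero_of_mul_uE`, `mem_of_mul_uH_add`, `mem_of_mul_uF`), each read off from an explicit
induced module. The given sequence is exact in the middle because, modulo c, every ef can be
replaced by -h²/4 (`exists_eq_casimir_mul`). -/

noncomputable section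

namespace SlTwoExt

universe u v w

/-! ### Generators and relations of U(𝔰𝔩₂) -/

section EnvelopingSlTwo

attribute [local instance] LieRing.ofAssociativeRing LieAlgebra.ofAssociativeAlgebra

variable (k : Type u) [Field k]

/-- The universal enveloping algebra of `𝔰𝔩₂(k)`. -/
abbrev USl : Type u := UniversalEnvelopingAlgebra k (slTwo k)

/-- The generator `e` of the enveloping algebra. -/
def uE : USl k := UniversalEnvelopingAlgebra.ι k (slE k)

/-- The generator `h` of the enveloping algebra. -/
def uH : USl k := UniversalEnvelopingAlgebra.ι k (slH k)

/-- The generator `f` of the enveloping algebra. -/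
def uF : USl k := UniversalEnvelopingAlgebra.ι k (slF k)

variable {k}

theorem slH_lie_slE : ⁅slH k, slE k⁆ = (2 : k) • slE k := by
  rw [slTwo_eq ⁅slH k, slE k⁆]
  simp only [slTwo_lie_apply]
  simp [slE, slH]
  norm_num

theorem slH_lie_slF : ⁅slH k, slF k⁆ = -((2 : k) • slF k) := by
  rw [slTwo_eq ⁅slH k, slF k⁆]
  simp only [slTwo_lie_apply]
  simp [slF, slH]
  rw [← neg_smul]
  norm_num

theorem slE_lie_slF : ⁅slE k, slF k⁆ = slH k := by
  rw [slTwo_eq ⁅slE k, slF k⁆]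
  simp only [slTwo_lie_apply]
  simp [slF, slE]

theorem uH_mul_uE : uH k * uE k = uE k * uH k + 2 * uE k := by
  have h := (UniversalEnvelopingAlgebra.ι k (L := slTwo k)).map_lie (slH k) (slE k)
  rw [slH_lie_slE, map_smul, LieRing.of_associative_ring_bracket, ofNat_smul_eq_nsmul k,
    nsmul_eq_mul] at h
  exact (sub_eq_iff_eq_add'.1 h.symm)

theorem uH_mul_uF : uH k * uF k = uF k * uH k - 2 * uF k := by
  have h := (UniversalEnvelopingAlgebra.ι k (L := slTwo k)).map_lie (slH k) (slF k)
  rw [slH_lie_slF, map_neg, map_smul, LieRing.of_associative_ring_bracket,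
    ofNat_smul_eq_nsmul k, nsmul_eq_mul] at h
  rw [sub_eq_add_neg]
  exact (sub_eq_iff_eq_add'.1 h.symm)

theorem uE_mul_uF : uE k * uF k = uF k * uE k + uH k := by
  have h := (UniversalEnvelopingAlgebra.ι k (L := slTwo k)).map_lie (slE k) (slF k)
  rw [slE_lie_slF, LieRing.of_associative_ring_bracket] at h
  exact (sub_eq_iff_eq_add'.1 h.symm)

/-- The algebra homomorphism out of the enveloping algebra given by an `𝔰𝔩₂`-triple. -/
def repHom {A : Type*} [Ring A] [Algebra k A] (E H F : A) (he : H * E = E * H + 2 * E)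
    (hf : H * F = F * H - 2 * F) (ef : E * F = F * E + H) : USl k →ₐ[k] A :=
  UniversalEnvelopingAlgebra.lift k
    { toFun := fun X => X.1 0 1 • E + X.1 0 0 • H + X.1 1 0 • F
      map_add' := fun X Y => by
        have h : ∀ i j, (X + Y).1 i j = X.1 i j + Y.1 i j := fun _ _ => rfl
        simp only [h, add_smul]
        abel
      map_smul' := fun r X => by
        have h : ∀ i j, (r • X).1 i j = r * X.1 i j := fun _ _ => rfl
        simp only [h, RingHom.id_apply, smul_add, smul_smul]
      map_lie' := fun {X Y} => by
        simp only [slTwo_lie_apply, slTwo_trace, LieRing.of_associative_ring_bracket, add_mul,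
          mul_add, smul_mul_smul_comm, he, hf, ef, smul_sub, smul_add, two_mul]
        module }

section repHom

variable {A : Type*} [Ring A] [Algebra k A] {E H F : A} {he : H * E = E * H + 2 * E}
    {hf : H * F = F * H - 2 * F} {ef : E * F = F * E + H}

@[simp]
theorem repHom_uE : repHom E H F he hf ef (uE k) = E := by
  rw [repHom, uE, UniversalEnvelopingAlgebra.lift_ι_apply]
  simp [slE]

@[simp]
theorem repHom_uH : repHom E H F he hf ef (uH k) = H := by
  rw [repHom, uH, UniversalEnvelopingAlgebra.lift_ι_apply]
  simp [slH]

@[simp]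
theorem repHom_uF : repHom E H F he hf ef (uF k) = F := by
  rw [repHom, uF, UniversalEnvelopingAlgebra.lift_ι_apply]
  simp [slF]

end repHom

theorem uSl_hom_ext {A : Type*} [Ring A] [Algebra k A] {φ ψ : USl k →ₐ[k] A}
    (he : φ (uE k) = ψ (uE k)) (hh : φ (uH k) = ψ (uH k)) (hf : φ (uF k) = ψ (uF k)) : φ = ψ := by
  apply (UniversalEnvelopingAlgebra.lift k).symm.injective
  ext X
  change φ (UniversalEnvelopingAlgebra.ι k X) = ψ (UniversalEnvelopingAlgebra.ι k X)
  rw [slTwo_eq X]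
  simp only [map_add, map_smul]
  change _ • φ (uE k) + _ • φ (uH k) + _ • φ (uF k) = _ • ψ (uE k) + _ • ψ (uH k) + _ • ψ (uF k)
  rw [he, hh, hf]

/-- The triple lives in S, so it defines a homomorphism U → S; followed by the inclusion it fixes
the generators, hence is the identity of U. -/
theorem uSl_mem_subalgebra (S : Subalgebra k (USl k)) (he : uE k ∈ S) (hh : uH k ∈ S)
    (hf : uF k ∈ S) (u : USl k) : u ∈ S := by
  let g : USl k →ₐ[k] S := repHom (⟨uE k, he⟩ : S) ⟨uH k, hh⟩ ⟨uF k, hf⟩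
    (Subtype.ext uH_mul_uE) (Subtype.ext uH_mul_uF) (Subtype.ext uE_mul_uF)
  have h : S.val.comp g = AlgHom.id k _ := by
    apply uSl_hom_ext <;> simp [g]
  have h3 : (g u : USl k) = u := DFunLike.congr_fun h u
  rw [← h3]
  exact (g u).2

/-- A linear map that intertwines the actions of `e`, `h` and `f` intertwines the actions of the
enveloping algebra. -/
theorem uSl_intertwine {W M : Type*} [AddCommGroup W] [Module k W] [AddCommGroup M] [Module k M]
    (ρ : USl k →ₐ[k] Module.End k W) (σ : USl k →ₐ[k] Module.End k M) (s : W →ₗ[k] M)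
    (he : s ∘ₗ ρ (uE k) = σ (uE k) ∘ₗ s) (hh : s ∘ₗ ρ (uH k) = σ (uH k) ∘ₗ s)
    (hf : s ∘ₗ ρ (uF k) = σ (uF k) ∘ₗ s) (x : USl k) (w : W) : s (ρ x w) = σ x (s w) := by
  let S : Subalgebra k (USl k) :=
    { carrier := {x | ∀ w, s (ρ x w) = σ x (s w)}
      mul_mem' := fun {a b} ha hb w => by
        simp only [Set.mem_ofPred_eq] at ha hb
        simp [ha, hb]
      add_mem' := fun {a b} ha hb w => by
        simp only [Set.mem_ofPred_eq] at ha hb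
        simp [ha, hb]
      algebraMap_mem' := fun r w => by simp [Module.algebraMap_end_apply] }
  exact uSl_mem_subalgebra S (fun w => LinearMap.congr_fun he w) (fun w => LinearMap.congr_fun hh w)
    (fun w => LinearMap.congr_fun hf w) x w

end EnvelopingSlTwo

/-! ### Modules induced from the Borel subalgebra ⟨h, e⟩ -/

section Induced

variable {k : Type u} [Field k] {Q : Type w} [AddCommGroup Q] [Module k Q]

/-- The action of `f` on the module induced from a representation of `⟨h, e⟩` on `Q`. -/
def indF : Module.End k (ℕ →₀ Q) := Finsupp.lsum k fun a => Finsupp.lsingle (a + 1)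

/-- The action of `h` on the module induced from a representation of `⟨h, e⟩` on `Q`. -/
def indH (H : Module.End k Q) : Module.End k (ℕ →₀ Q) :=
  Finsupp.lsum k fun a => Finsupp.lsingle a ∘ₗ (H - (2 * a : k) • LinearMap.id)

/-- The action of `e` on the module induced from a representation of `⟨h, e⟩` on `Q`. -/
def indE (H E : Module.End k Q) : Module.End k (ℕ →₀ Q) :=
  -- The index a stands for fᵃ ⊗ -, and the formula is e fᵃ = fᵃ e + a fᵃ⁻¹(h - (a - 1)). At a = 0
  -- the truncated exponent is harmless, since its coefficient is a.
  Finsupp.lsum k fun a => Finsupp.lsingle a ∘ₗ E +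
    (a : k) • (Finsupp.lsingle (a - 1) ∘ₗ (H - (a - 1 : k) • LinearMap.id))

@[simp]
theorem indF_single (a : ℕ) (q : Q) :
    indF (k := k) (Finsupp.single a q) = Finsupp.single (a + 1) q := by
  simp [indF]

@[simp]
theorem indH_single (H : Module.End k Q) (a : ℕ) (q : Q) :
    indH H (Finsupp.single a q) = Finsupp.single a (H q - (2 * a : k) • q) := by
  simp [indH]

@[simp]
theorem indE_single_zero (H E : Module.End k Q) (q : Q) :
    indE H E (Finsupp.single 0 q) = Finsupp.single 0 (E q) := by
  simp [indE]

@[simp]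
theorem indE_single_succ (H E : Module.End k Q) (a : ℕ) (q : Q) :
    indE H E (Finsupp.single (a + 1) q) = Finsupp.single (a + 1) (E q) +
      Finsupp.single a ((a + 1 : k) • (H q - (a : k) • q)) := by
  rw [← Finsupp.smul_single]
  simp [indE, Finsupp.single_sub]

/-- The representation of the enveloping algebra of `𝔰𝔩₂` induced from a representation `Q` of
`⟨h, e⟩`. -/
def indRep (H E : Module.End k Q) (he : H * E = E * H + 2 * E) :
    USl k →ₐ[k] Module.End k (ℕ →₀ Q) :=
  repHom (indE H E) (indH H) indF
    (by
      have he' : ∀ q, H (E q) = E (H q) + (2 : k) • E q := fun q => by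
        rw [ofNat_smul_eq_nsmul k, two_nsmul]
        simpa [two_mul] using LinearMap.congr_fun he q
      ext a q : 2
      rw [two_mul]
      rcases a with _ | a
      · simp only [LinearMap.comp_apply, Module.End.mul_apply, Finsupp.lsingle_apply,
          LinearMap.add_apply, indH_single, indE_single_zero, ← Finsupp.single_add]
        congr 1
        simp only [he', map_sub, map_smul]
        push_cast
        module
      · simp only [LinearMap.comp_apply, Module.End.mul_apply, Finsupp.lsingle_apply,
          LinearMap.add_apply, indH_single, indE_single_succ, map_add]
        rw [add_add_add_comm (Finsupp.single (a + 1) (E q)), add_add_add_comm]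
        simp only [← Finsupp.single_add]
        congr 2
        · simp only [he', map_sub, map_smul]
          push_cast
          module
        · simp only [map_sub, map_smul]
          push_cast
          module)
    (by
      ext a q : 2
      rw [two_mul]
      simp only [LinearMap.comp_apply, Module.End.mul_apply, Finsupp.lsingle_apply,
        LinearMap.add_apply, LinearMap.sub_apply, indH_single, indF_single, ← Finsupp.single_add,
        ← Finsupp.single_sub]
      congr 1
      push_cast
      module)
    (by
      ext a q : 2
      rcases a with _ | a
      · simp only [LinearMap.comp_apply, Module.End.mul_apply, Finsupp.lsingle_apply,
          LinearMap.add_apply, indH_single, indF_single, indE_single_zero, indE_single_succ]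
        congr 2
        push_cast
        module
      · simp only [LinearMap.comp_apply, Module.End.mul_apply, Finsupp.lsingle_apply,
          LinearMap.add_apply, indH_single, indF_single, indE_single_succ, map_add,
          add_assoc (Finsupp.single (_ : ℕ) (_ : Q)), ← Finsupp.single_add]
        congr 2
        push_cast
        module)

/-- The universal property of an induced module. -/
theorem indRep_lift {M : Type*} [AddCommGroup M] [Module k M] (H E : Module.End k Q)
    (he : H * E = E * H + 2 * E) (σ : USl k →ₐ[k] Module.End k M) (φ : Q →ₗ[k] M)
    (hφH : ∀ q, φ (H q) = σ (uH k) (φ q)) (hφE : ∀ q, φ (E q) = σ (uE k) (φ q)) :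
    ∃ s : (ℕ →₀ Q) →ₗ[k] M, (∀ q, s (Finsupp.single 0 q) = φ q) ∧
      ∀ x w, s (indRep H E he x w) = σ x (s w) := by
  let s : (ℕ →₀ Q) →ₗ[k] M := Finsupp.lsum k fun a =>
    LinearMap.comp ((σ (uF k)) ^ a : Module.End k M) φ
  have hs : ∀ a q, s (Finsupp.single a q) = ((σ (uF k)) ^ a) (φ q) := fun a q => by simp [s]
  have h0 : ∀ q, s (Finsupp.single 0 q) = φ q := fun q => by simp [hs]
  have hsucc : ∀ a q, s (Finsupp.single (a + 1) q) = σ (uF k) (s (Finsupp.single a q)) :=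
    fun a q => by rw [hs, hs, pow_succ']; rfl
  have cHF : ∀ m, σ (uH k) (σ (uF k) m) = σ (uF k) (σ (uH k) m) - (2 : k) • σ (uF k) m :=
    fun m => by
      rw [ofNat_smul_eq_nsmul k, two_nsmul, ← map_add, ← Module.End.mul_apply, ← map_mul,
        uH_mul_uF]
      simp [two_mul]
  have cEF : ∀ m, σ (uE k) (σ (uF k) m) = σ (uF k) (σ (uE k) m) + σ (uH k) m := fun m => by
    rw [← Module.End.mul_apply, ← map_mul, uE_mul_uF]
    simp
  have hH : ∀ a q, s (indH H (Finsupp.single a q)) = σ (uH k) (s (Finsupp.single a q)) := by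
    intro a
    induction a with
    | zero => intro q; simp [h0, hφH]
    | succ a ih =>
      intro q
      have := ih q
      simp only [indH_single] at this ⊢
      rw [hsucc a q, cHF, ← this, ← hsucc, ← hsucc, ← map_smul, ← map_sub, Finsupp.smul_single,
        ← Finsupp.single_sub]
      congr 2
      push_cast
      module
  refine ⟨s, h0, uSl_intertwine _ _ s ?_ ?_ ?_⟩
  · ext a q : 2
    simp only [indRep, repHom_uE, LinearMap.comp_apply, Finsupp.lsingle_apply]
    induction a with
    | zero => simp [h0, hφE]
    | succ a ih =>
      -- One factor f is moved past e by ef = fe + h; the shorter power is handled by induction and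
      -- the h-term by `hH`.
      rw [hsucc a q, cEF, ← ih, ← hH]
      rcases a with _ | a
      · simp [hsucc]
      · simp only [indE_single_succ, indH_single, map_add, ← hsucc]
        rw [← map_add s, ← map_add s, ← map_add s, add_assoc (Finsupp.single (_ : ℕ) (_ : Q)),
          ← Finsupp.single_add]
        congr 3
        push_cast
        module
  · ext a q : 2
    simp only [indRep, repHom_uH, LinearMap.comp_apply, Finsupp.lsingle_apply, hH]
  · ext a q : 2
    simp [indRep, hsucc]

end Induced

section Induced

variable {k : Type u} [Field k] {Q Q' : Type*} [AddCommGroup Q] [Module k Q]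
  [AddCommGroup Q'] [Module k Q']

/-- Functoriality of induced modules. -/
theorem indRep_map (H E : Module.End k Q) (he : H * E = E * H + 2 * E)
    (H' E' : Module.End k Q') (he' : H' * E' = E' * H' + 2 * E') (T : Q →ₗ[k] Q')
    (hTH : ∀ q, T (H q) = H' (T q)) (hTE : ∀ q, T (E q) = E' (T q)) (x : USl k) (w : ℕ →₀ Q) :
    Finsupp.mapRange.linearMap T (indRep H E he x w) =
      indRep H' E' he' x (Finsupp.mapRange.linearMap T w) := by
  refine uSl_intertwine _ _ _ ?_ ?_ ?_ x w
  · ext a q : 2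
    rcases a with _ | a
    · simp only [indRep, repHom_uE, LinearMap.comp_apply, Finsupp.lsingle_apply, indE_single_zero,
        Finsupp.mapRange.linearMap_apply, Finsupp.mapRange_single, hTE]
    · simp only [indRep, repHom_uE, LinearMap.comp_apply, Finsupp.lsingle_apply, indE_single_succ,
        map_add]
      simp only [Finsupp.mapRange.linearMap_apply, Finsupp.mapRange_single, indE_single_succ,
        map_smul, map_sub, hTE, hTH]
  · ext a q : 2
    simp only [indRep, repHom_uH, LinearMap.comp_apply, Finsupp.lsingle_apply, indH_single,
      Finsupp.mapRange.linearMap_apply, Finsupp.mapRange_single, map_smul, map_sub, hTH]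
  · ext a q : 2
    simp only [indRep, repHom_uF, LinearMap.comp_apply, Finsupp.lsingle_apply, indF_single,
      Finsupp.mapRange.linearMap_apply, Finsupp.mapRange_single]

theorem indRep_uE_single_zero (H E : Module.End k Q) (he : H * E = E * H + 2 * E) (q : Q) :
    indRep H E he (uE k) (Finsupp.single 0 q) = Finsupp.single 0 (E q) := by
  simp [indRep]

theorem indRep_uH_single_zero (H E : Module.End k Q) (he : H * E = E * H + 2 * E) (q : Q) :
    indRep H E he (uH k) (Finsupp.single 0 q) = Finsupp.single 0 (H q) := by
  simp [indRep]

theorem indRep_uF_single (H E : Module.End k Q) (he : H * E = E * H + 2 * E) (a : ℕ) (q : Q) :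
    indRep H E he (uF k) (Finsupp.single a q) = Finsupp.single (a + 1) q := by
  simp [indRep]

end Induced

/-! ### Cancellation for right multiplication in U, and the augmentation ideal -/

section RightMultiplication

open Polynomial

variable {k : Type u} [Field k]

/-- Iterates eh = (h - 2)e. It is the source of the substitution X ↦ X - 2 in `borelE`. -/
theorem uE_mul_aeval_uH (p : k[X]) :
    uE k * aeval (uH k) p = aeval (uH k) (aeval (X - 2 : k[X]) p) * uE k := by
  induction p using Polynomial.induction_on' with
  | add p q hp hq => simp only [map_add, mul_add, add_mul, hp, hq]
  | monomial n a =>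
    rw [← C_mul_X_pow_eq_monomial]
    simp only [map_mul, aeval_C, map_pow, aeval_X, map_sub, map_ofNat, Polynomial.algebraMap_eq]
    rw [← mul_assoc, ← Algebra.commutes, mul_assoc, mul_assoc]
    congr 1
    induction n with
    | zero => simp
    | succ n ih =>
      rw [pow_succ, ← mul_assoc, ih, pow_succ, mul_assoc, mul_assoc, sub_mul, uH_mul_uE]
      simp

/-- The operator `h` on `U(⟨h, e⟩)`, with basis the monomials `hᵇeᶜ`. -/
def borelH : Module.End k (ℕ →₀ k[X]) :=
  Finsupp.lsum k fun c => Finsupp.lsingle c ∘ₗ LinearMap.mulLeft k X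

/-- The operator `e` on `U(⟨h, e⟩)`, with basis the monomials `hᵇeᶜ`. -/
def borelE : Module.End k (ℕ →₀ k[X]) :=
  Finsupp.lsum k fun c => Finsupp.lsingle (c + 1) ∘ₗ (aeval (X - 2 : k[X])).toLinearMap

@[simp]
theorem borelH_single (c : ℕ) (p : k[X]) :
    borelH (Finsupp.single c p) = Finsupp.single c (X * p) := by
  simp only [borelH, Finsupp.lsum_single, LinearMap.comp_apply, Finsupp.lsingle_apply,
    LinearMap.mulLeft_apply]

@[simp]
theorem borelE_single (c : ℕ) (p : k[X]) :
    borelE (Finsupp.single c p) = Finsupp.single (c + 1) (aeval (X - 2 : k[X]) p) := by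
  simp only [borelE, Finsupp.lsum_single, LinearMap.comp_apply, Finsupp.lsingle_apply,
    AlgHom.toLinearMap_apply]

theorem borel_rel : (borelH : Module.End k (ℕ →₀ k[X])) * borelE = borelE * borelH + 2 * borelE := by
  refine Finsupp.lhom_ext fun c p => ?_
  rw [two_mul]
  simp only [Module.End.mul_apply, LinearMap.add_apply, borelH_single, borelE_single,
    ← Finsupp.single_add, map_mul, aeval_X]
  congr 1
  ring

/-- Right multiplication by `e` on the enveloping algebra is injective. -/
theorem eq_zero_of_mul_uE {x : USl k} (hx : x * uE k = 0) : x = 0 := by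
  let φ : (ℕ →₀ k[X]) →ₗ[k] USl k := Finsupp.lsum k fun c =>
    LinearMap.mulRight k (uE k ^ c) ∘ₗ (aeval (uH k)).toLinearMap
  have hφ : ∀ c p, φ (Finsupp.single c p) = aeval (uH k) p * uE k ^ c := fun c p => by simp [φ]
  obtain ⟨s, hs0, hs⟩ := indRep_lift borelH borelE borel_rel (Algebra.lsmul k k (USl k)) φ
    (fun q => by
      induction q using Finsupp.induction_linear with
      | zero => simp
      | add a b ha hb => simp only [map_add, ha, hb]
      | single c p =>
        simp only [borelH_single, hφ, map_mul, aeval_X, mul_assoc, Algebra.lsmul_coe, smul_eq_mul])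
    (fun q => by
      induction q using Finsupp.induction_linear with
      | zero => simp
      | add a b ha hb => simp only [map_add, ha, hb]
      | single c p =>
        simp only [borelE_single, hφ, Algebra.lsmul_coe, smul_eq_mul, ← mul_assoc,
          uE_mul_aeval_uH]
        rw [mul_assoc, pow_succ'])
  -- R is right multiplication by e in the basis hᵇeᶜ. It is injective, commutes with the left
  -- action and takes the generator v to ev; so xe = 0 gives R(xv) = xev = 0, hence xv = 0, and s
  -- carries xv to x.
  let R : (ℕ →₀ k[X]) →ₗ[k] (ℕ →₀ k[X]) := Finsupp.lmapDomain _ k Nat.succ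
  let v : ℕ →₀ (ℕ →₀ k[X]) := Finsupp.single 0 (Finsupp.single 0 1)
  have hR := indRep_map borelH borelE borel_rel borelH borelE borel_rel R
    (fun q => by
      induction q using Finsupp.induction_linear with
      | zero => simp
      | add a b ha hb => simp only [map_add, ha, hb]
      | single c p => simp only [borelH_single, R, Finsupp.lmapDomain_apply, Finsupp.mapDomain_single])
    (fun q => by
      induction q using Finsupp.induction_linear with
      | zero => simp
      | add a b ha hb => simp only [map_add, ha, hb]
      | single c p => simp only [borelE_single, R, Finsupp.lmapDomain_apply, Finsupp.mapDomain_single])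
  have hRv : indRep borelH borelE borel_rel (uE k) v = Finsupp.mapRange.linearMap R v := by
    simp [v, indRep, R, Finsupp.lmapDomain_apply, Finsupp.mapDomain_single]
  have hw : indRep borelH borelE borel_rel x v = 0 := by
    have h := hR x v
    rw [← hRv, ← Module.End.mul_apply (indRep _ _ _ x), ← map_mul, hx, map_zero, LinearMap.zero_apply] at h
    have hinj : Function.Injective (Finsupp.mapRange.linearMap (α := ℕ) R) :=
      Finsupp.mapRange_injective _ (map_zero R) (Finsupp.mapDomain_injective Nat.succ_injective)
    exact hinj (h.trans (map_zero _).symm)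
  have h1 := hs x v
  rw [hw, map_zero, hs0, hφ] at h1
  simpa using h1.symm

theorem mk_uE_mul {I : Ideal (USl k)} (hI : uE k ∈ I) (p : k[X]) :
    uE k • (Submodule.Quotient.mk (aeval (uH k) p) : USl k ⧸ I) = 0 := by
  rw [← Submodule.Quotient.mk_smul, Submodule.Quotient.mk_eq_zero, smul_eq_mul, uE_mul_aeval_uH]
  exact I.mul_mem_left _ hI

/-- Right multiplication by `h + r` is injective modulo the left ideal generated by `e`. -/
theorem mem_of_mul_uH_add (r : k) {x y : USl k}
    (hx : x * (uH k + algebraMap k (USl k) r) = y * uE k) : ∃ z, x = z * uE k := by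
  let I : Ideal (USl k) := Ideal.span {uE k}
  have hI : uE k ∈ I := Ideal.mem_span_singleton_self _
  let H : Module.End k k[X] := LinearMap.mulLeft k X
  let φ : k[X] →ₗ[k] USl k ⧸ I := (I.mkQ.restrictScalars k) ∘ₗ (aeval (uH k)).toLinearMap
  have hrel : H * 0 = 0 * H + 2 * 0 := by simp
  obtain ⟨s, hs0, hs⟩ := indRep_lift H 0 hrel (Algebra.lsmul k k (USl k ⧸ I)) φ
    (fun q => by simp [H, φ, ← Submodule.Quotient.mk_smul])
    (fun q => by
      change φ 0 = uE k • (Submodule.Quotient.mk (aeval (uH k) q) : USl k ⧸ I)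
      rw [mk_uE_mul hI, map_zero])
  -- The induced module with e acting by 0 on k[h] is a model of U/Ue, and there right
  -- multiplication by h + r is multiplication by the nonzero polynomial X + r.
  let R : k[X] →ₗ[k] k[X] := LinearMap.mulLeft k (X + C r)
  let v : ℕ →₀ k[X] := Finsupp.single 0 1
  have hR := indRep_map H 0 hrel H 0 hrel R (fun q => by simp [H, R]; ring) (fun q => by simp)
  have hRv : indRep H 0 hrel (uH k + algebraMap k (USl k) r) v = Finsupp.mapRange.linearMap R v := by
    simp [v, indRep_uH_single_zero, H, R, Module.algebraMap_end_apply, ← Finsupp.single_add,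
      Algebra.smul_def]
  have hw : indRep H 0 hrel x v = 0 := by
    have h := hR x v
    rw [← hRv, ← Module.End.mul_apply (indRep _ _ _ x), ← map_mul, hx, map_mul, Module.End.mul_apply,
      indRep_uE_single_zero, LinearMap.zero_apply, Finsupp.single_zero, map_zero] at h
    have hinj : Function.Injective (Finsupp.mapRange.linearMap (α := ℕ) R) :=
      Finsupp.mapRange_injective _ (map_zero R) (mul_right_injective₀ (X_add_C_ne_zero r))
    exact hinj (h.trans (map_zero _).symm)
  have h1 := hs x v
  rw [hw, map_zero, hs0] at h1
  have h2 : (Submodule.Quotient.mk x : USl k ⧸ I) = 0 := by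
    rw [h1]
    simp [φ, ← Submodule.Quotient.mk_smul]
  rw [Submodule.Quotient.mk_eq_zero] at h2
  obtain ⟨z, hz⟩ := Ideal.mem_span_singleton'.1 h2
  exact ⟨z, hz.symm⟩

/-- Right multiplication by `f` is injective from the quotient by the left ideal generated by `e`
and `h + 2` to the quotient by the left ideal generated by `e` and `h`. -/
theorem mem_of_mul_uF {x y z : USl k} (hx : x * uF k = y * uE k + z * uH k) :
    ∃ a b, x = a * uE k + b * (uH k + 2) := by
  let I : Ideal (USl k) := Ideal.span {uE k, uH k + 2}
  have hIE : uE k ∈ I := Ideal.subset_span (by simp)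
  have hIH : uH k + 2 ∈ I := Ideal.subset_span (by simp)
  let H : Module.End k k := (-2 : k) • LinearMap.id
  let φ : k →ₗ[k] USl k ⧸ I := LinearMap.toSpanSingleton k _ (Submodule.Quotient.mk 1)
  have hrel : H * 0 = 0 * H + 2 * 0 := by simp
  have hrel0 : (0 : Module.End k k) * 0 = 0 * 0 + 2 * 0 := by simp
  obtain ⟨s, hs0, hs⟩ := indRep_lift H 0 hrel (Algebra.lsmul k k (USl k ⧸ I)) φ
    (fun q => by
      have h : uH k • (Submodule.Quotient.mk 1 : USl k ⧸ I) =
          (-2 : k) • (Submodule.Quotient.mk 1 : USl k ⧸ I) := by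
        rw [← Submodule.Quotient.mk_smul, ← Submodule.Quotient.mk_smul, Submodule.Quotient.eq]
        simpa [Algebra.smul_def, map_ofNat] using hIH
      simp [H, φ, h, smul_smul, mul_comm])
    (fun q => by
      have h := mk_uE_mul hIE (1 : k[X])
      rw [map_one] at h
      simp [φ, h])
  -- T embeds the Verma module of highest weight -2 into that of highest weight 0, taking the
  -- generator to fv: this vector is singular because efv = hv = 0. The element xf kills v by
  -- hypothesis, so x kills the generator of weight -2.
  let T : (ℕ →₀ k) →ₗ[k] (ℕ →₀ k) := Finsupp.lmapDomain _ k Nat.succ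
  have hTs : ∀ a (c : k), T (Finsupp.single a c) = Finsupp.single (a + 1) c := fun a c => by
    simp [T, Finsupp.lmapDomain_apply, Finsupp.mapDomain_single]
  let v : ℕ →₀ k := Finsupp.single 0 1
  have hT : ∀ x w, T (indRep H 0 hrel x w) = indRep 0 0 hrel0 x (T w) := by
    refine uSl_intertwine _ _ _ ?_ ?_ ?_
    · refine Finsupp.lhom_ext fun a c => ?_
      rcases a with _ | a
      · simp [indRep, hTs]
      · simp only [indRep, repHom_uE, LinearMap.comp_apply, hTs, indE_single_succ, map_add,
          LinearMap.zero_apply, H, LinearMap.smul_apply, LinearMap.id_apply, smul_eq_mul]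
        congr 2
        push_cast
        ring
    · refine Finsupp.lhom_ext fun a c => ?_
      simp only [indRep, repHom_uH, LinearMap.comp_apply, hTs, indH_single, LinearMap.zero_apply, H,
        LinearMap.smul_apply, LinearMap.id_apply, smul_eq_mul]
      congr 1
      push_cast
      ring
    · refine Finsupp.lhom_ext fun a c => ?_
      simp [indRep, hTs]
  have hTv : indRep 0 0 hrel0 (uF k) v = T v := by simp [v, indRep_uF_single, hTs]
  have hw : indRep H 0 hrel x v = 0 := by
    have h := hT x v
    rw [← hTv, ← Module.End.mul_apply (indRep _ _ _ x), ← map_mul, hx, map_add, map_mul, map_mul,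
      LinearMap.add_apply, Module.End.mul_apply, Module.End.mul_apply,
      indRep_uE_single_zero, indRep_uH_single_zero, LinearMap.zero_apply, Finsupp.single_zero,
      map_zero, map_zero, add_zero] at h
    exact Finsupp.mapDomain_injective Nat.succ_injective (h.trans (map_zero T).symm)
  have h1 := hs x v
  rw [hw, map_zero, hs0] at h1
  have h2 : (Submodule.Quotient.mk x : USl k ⧸ I) = 0 := by
    rw [h1]
    simp [φ, ← Submodule.Quotient.mk_smul]
  rw [Submodule.Quotient.mk_eq_zero] at h2
  obtain ⟨a, b, hab⟩ := Submodule.mem_span_pair.1 h2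
  exact ⟨a, b, hab.symm⟩

variable (k) in
/-- The augmentation of the enveloping algebra. -/
def uAug : USl k →ₐ[k] k := repHom 0 0 0 (by simp) (by simp) (by simp)

theorem mem_of_uAug_eq_zero {x : USl k} (hx : uAug k x = 0) :
    ∃ a b c, x = a * uE k + b * uH k + c * uF k := by
  let I : Ideal (USl k) := Ideal.span {uE k, uH k, uF k}
  let S : Subalgebra k (USl k) :=
    { carrier := {x | x - algebraMap k _ (uAug k x) ∈ I}
      mul_mem' := fun {a b} ha hb => by
        simp only [Set.mem_ofPred_eq] at ha hb ⊢
        have h : a * b - algebraMap k _ (uAug k (a * b)) = a * (b - algebraMap k _ (uAug k b)) +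
            algebraMap k _ (uAug k b) * (a - algebraMap k _ (uAug k a)) := by
          rw [map_mul (uAug k), mul_comm (uAug k a), map_mul (algebraMap k (USl k)), mul_sub,
            mul_sub, ← Algebra.commutes (uAug k b) a]
          abel
        rw [h]
        exact I.add_mem (I.mul_mem_left _ hb) (I.mul_mem_left _ ha)
      add_mem' := fun {a b} ha hb => by
        simp only [Set.mem_ofPred_eq] at ha hb ⊢
        rw [map_add, map_add, add_sub_add_comm]
        exact I.add_mem ha hb
      algebraMap_mem' := fun r => by simp }
  have h : x ∈ S := by
    apply uSl_mem_subalgebra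
    · change uE k - algebraMap k _ (uAug k (uE k)) ∈ I
      simp only [uAug, repHom_uE, map_zero, sub_zero]
      exact Ideal.subset_span (by simp)
    · change uH k - algebraMap k _ (uAug k (uH k)) ∈ I
      simp only [uAug, repHom_uH, map_zero, sub_zero]
      exact Ideal.subset_span (by simp)
    · change uF k - algebraMap k _ (uAug k (uF k)) ∈ I
      simp only [uAug, repHom_uF, map_zero, sub_zero]
      exact Ideal.subset_span (by simp)
  change x - algebraMap k _ (uAug k x) ∈ I at h
  rw [hx, map_zero, sub_zero] at h
  obtain ⟨a, b, c, habc⟩ := Submodule.mem_span_triple.1 h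
  exact ⟨a, b, c, habc.symm⟩

end RightMultiplication

/-! ### The Koszul resolution of the trivial module -/

section Koszul

variable (k : Type u) [Field k]

/-- The middle differential of the Koszul resolution of the trivial module of `U(𝔰𝔩₂)`. -/
def koszulTwo : (USl k × USl k × USl k) →ₗ[USl k] (USl k × USl k × USl k) :=
  -- The three rows are the relations ef - fe - h = 0, (h - 2)e = eh and (h + 2)f = fh, read as
  -- left-linear relations among e, h, f.
  (LinearMap.toSpanSingleton (USl k) _ (-uF k, -1, uE k)).coprod
    ((LinearMap.toSpanSingleton (USl k) _ (uH k - 2, -uE k, 0)).coprod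
      (LinearMap.toSpanSingleton (USl k) _ (0, -uF k, uH k + 2)))

/-- The first differential of the Koszul resolution of the trivial module of `U(𝔰𝔩₂)`. -/
def koszulOne : (USl k × USl k × USl k) →ₗ[USl k] USl k :=
  (LinearMap.toSpanSingleton (USl k) _ (uE k)).coprod
    ((LinearMap.toSpanSingleton (USl k) _ (uH k)).coprod
      (LinearMap.toSpanSingleton (USl k) _ (uF k)))

/-- The last differential of the Koszul resolution of the trivial module of `U(𝔰𝔩₂)`. -/
def koszulThree : USl k →ₗ[USl k] (USl k × USl k × USl k) :=
  LinearMap.toSpanSingleton (USl k) _ (uH k, uF k, -uE k)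

variable {k}

theorem koszulOne_apply (a b c : USl k) :
    koszulOne k (a, b, c) = a * uE k + b * uH k + c * uF k := by
  simp [koszulOne, add_assoc]

theorem koszulTwo_apply (x y z : USl k) :
    koszulTwo k (x, y, z) =
      (y * (uH k - 2) - x * uF k, -x - y * uE k - z * uF k, x * uE k + z * (uH k + 2)) := by
  simp only [koszulTwo, LinearMap.coprod_apply, LinearMap.toSpanSingleton_apply, Prod.smul_mk,
    smul_eq_mul, Prod.mk_add_mk, mul_neg, mul_one, mul_zero, zero_add, add_zero]
  refine Prod.ext ?_ (Prod.ext ?_ rfl) <;> (simp only; abel)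

theorem koszulThree_apply (w : USl k) :
    koszulThree k w = (w * uH k, w * uF k, -(w * uE k)) := by
  simp [koszulThree]

theorem uE_mul_uH_add_two : uE k * (uH k + 2) = uH k * uE k := by
  rw [uH_mul_uE, mul_add, mul_two, two_mul]

theorem uF_mul_uH_sub_two : uF k * (uH k - 2) = uH k * uF k := by
  rw [uH_mul_uF, mul_sub, mul_two, two_mul]

theorem uH_sub_two_mul_uE : (uH k - 2) * uE k = uE k * uH k := by
  rw [sub_mul, uH_mul_uE, add_sub_cancel_right]

theorem uH_add_two_mul_uF : (uH k + 2) * uF k = uF k * uH k := by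
  rw [add_mul, uH_mul_uF, sub_add_cancel]

theorem koszulThree_injective : Function.Injective (koszulThree k) := by
  rw [injective_iff_map_eq_zero]
  intro w hw
  rw [koszulThree_apply, Prod.mk_eq_zero, Prod.mk_eq_zero, neg_eq_zero] at hw
  exact eq_zero_of_mul_uE hw.2.2

/-- For a cycle (x, y, z), the third coordinate puts z(h + 2) in Ue, so z = we by cancellation
modulo e. Cancelling e on the right then determines x from the third coordinate and y from the
second, both in terms of w. -/
theorem koszul_exact_two : Function.Exact (koszulThree k) (koszulTwo k) := by
  rintro ⟨x, y, z⟩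
  constructor
  · intro h
    rw [koszulTwo_apply, Prod.mk_eq_zero, Prod.mk_eq_zero] at h
    obtain ⟨-, h2, h3⟩ := h
    obtain ⟨w, rfl⟩ : ∃ w, z = w * uE k := by
      refine mem_of_mul_uH_add 2 (y := -x) ?_
      rw [map_ofNat, neg_mul]
      exact eq_neg_of_add_eq_zero_right h3
    have hx : x = -w * uH k := by
      rw [mul_assoc, uE_mul_uH_add_two, ← mul_assoc, ← add_mul] at h3
      rw [neg_mul]
      exact eq_neg_of_add_eq_zero_left (eq_zero_of_mul_uE h3)
    have hy : y + w * uF k = 0 := by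
      apply eq_zero_of_mul_uE
      rw [hx, mul_assoc, uE_mul_uF] at h2
      rw [add_mul, ← neg_eq_zero, ← h2]
      noncomm_ring
    refine ⟨-w, ?_⟩
    rw [koszulThree_apply, hx, eq_neg_of_add_eq_zero_left hy, neg_mul, neg_mul, neg_mul, neg_neg]
  · rintro ⟨w, hw⟩
    rw [← hw, koszulThree_apply, koszulTwo_apply, Prod.mk_eq_zero, Prod.mk_eq_zero]
    refine ⟨?_, ?_, ?_⟩
    · rw [mul_assoc, uF_mul_uH_sub_two, ← mul_assoc, sub_self]
    · rw [neg_mul, mul_assoc, mul_assoc, uE_mul_uF]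
      noncomm_ring
    · rw [neg_mul, mul_assoc, mul_assoc, uE_mul_uH_add_two, add_neg_cancel]

/-- A relation ae + bh + cf = 0 is reduced one generator at a time: the Verma embedding puts c in Ue
+ U(h + 2), subtracting the corresponding boundaries leaves a relation between e and h only, and
there cancellation of h modulo e and then of e finishes. -/
theorem koszul_exact_one : Function.Exact (koszulTwo k) (koszulOne k) := by
  rintro ⟨a, b, c⟩
  constructor
  · intro h
    rw [koszulOne_apply] at h
    obtain ⟨x, z, rfl⟩ : ∃ x z, c = x * uE k + z * (uH k + 2) := by
      refine mem_of_mul_uF (y := -a) (z := -b) ?_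
      rw [eq_neg_of_add_eq_zero_right h, neg_mul, neg_mul, neg_add]
    have h1 : (a + x * uF k) * uE k + (b + x + z * uF k) * uH k = 0 := by
      rw [← h, add_mul (x * uE k), mul_assoc x, mul_assoc z, uE_mul_uF, uH_add_two_mul_uF]
      noncomm_ring
    obtain ⟨y, hy⟩ : ∃ y, b + x + z * uF k = y * uE k := by
      refine mem_of_mul_uH_add 0 (y := -(a + x * uF k)) ?_
      rw [map_zero, add_zero, eq_neg_of_add_eq_zero_right h1, neg_mul]
    have ha : a + x * uF k + y * (uH k - 2) = 0 := by
      apply eq_zero_of_mul_uE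
      rw [add_mul, mul_assoc y, uH_sub_two_mul_uE, ← mul_assoc, ← hy, h1]
    refine ⟨(x, -y, z), ?_⟩
    rw [koszulTwo_apply]
    refine Prod.ext ?_ (Prod.ext ?_ rfl)
    · rw [add_assoc, add_comm (x * uF k)] at ha
      rw [eq_neg_of_add_eq_zero_left ha]
      noncomm_ring
    · change -x - -y * uE k - z * uF k = b
      rw [neg_mul, ← hy]
      abel
  · rintro ⟨⟨x, y, z⟩, h⟩
    rw [← h, koszulTwo_apply, koszulOne_apply, sub_mul, mul_assoc y, uH_sub_two_mul_uE, sub_mul,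
      sub_mul, add_mul, mul_assoc x, mul_assoc x, uE_mul_uF, mul_assoc z (uH k + 2),
      uH_add_two_mul_uF]
    noncomm_ring

/-! ### Homomorphisms out of free modules, and kernel sequences -/

section Elements

variable {A : Type u} [Ring A] (N : ModuleCat.{u} A)

/-- The homomorphism `A → N` of `A`-modules with a given value at `1`. -/
def elementHom (n : N) : ModuleCat.of A A ⟶ N := ModuleCat.ofHom (LinearMap.toSpanSingleton A N n)

variable {N}

theorem eq_elementHom (g : ModuleCat.of A A ⟶ N) : g = elementHom N (g.hom (1 : A)) := by
  ext
  exact (one_smul A (g.hom (1 : A))).symm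

variable (N) in
/-- The homomorphism `A³ → N` of `A`-modules with given values on the standard basis. -/
def elementHomThree (x y z : N) : ModuleCat.of A (A × A × A) ⟶ N :=
  ModuleCat.ofHom ((LinearMap.toSpanSingleton A N x).coprod
    ((LinearMap.toSpanSingleton A N y).coprod (LinearMap.toSpanSingleton A N z)))

theorem elementHomThree_basis (x y z : N) :
    (elementHomThree N x y z).hom (1, 0, 0) = x ∧ (elementHomThree N x y z).hom (0, 1, 0) = y ∧
      (elementHomThree N x y z).hom (0, 0, 1) = z := by
  simp [elementHomThree]

/-- The sequence `0 → ker g → M → N`. -/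
abbrev kerSeq {M N : ModuleCat.{u} A} (g : M ⟶ N) : ShortComplex (ModuleCat.{u} A) where
  X₁ := ModuleCat.of A (LinearMap.ker g.hom)
  X₂ := M
  X₃ := N
  f := ModuleCat.ofHom (LinearMap.ker g.hom).subtype
  g := g
  zero := by ext x; exact x.2

theorem kerSeq_shortExact {M N : ModuleCat.{u} A} {g : M ⟶ N} (hg : Function.Surjective g.hom) :
    (kerSeq g).ShortExact :=
  ModuleCat.shortComplex_shortExact _ (fun x => by simp) (LinearMap.ker g.hom).injective_subtype hg

end Elements

/-! ### Representations and the trivial representation as U-modules -/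

section UModule

variable {M : Type u} [AddCommGroup M] [Module k M] [LieRingModule (slTwo k) M]
    [LieModule k (slTwo k) M]

/-- An element of a representation, as an element of the corresponding module over the enveloping
algebra. -/
def uMk : M →+ uModule k (slTwo k) M where
  toFun m := m
  map_zero' := rfl
  map_add' _ _ := rfl

theorem uMk_bijective : Function.Bijective (uMk : M →+ uModule k (slTwo k) M) :=
  Function.bijective_id

theorem smul_uMk (x : USl k) (m : M) :
    x • (uMk m : uModule k (slTwo k) M) =
      uMk (UniversalEnvelopingAlgebra.lift k (LieModule.toEnd k (slTwo k) M) x m) := rfl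

theorem uE_smul_uMk (m : M) : uE k • (uMk m : uModule k (slTwo k) M) = uMk ⁅slE k, m⁆ := by
  rw [smul_uMk, uE, UniversalEnvelopingAlgebra.lift_ι_apply, LieModule.toEnd_apply_apply]

theorem uH_smul_uMk (m : M) : uH k • (uMk m : uModule k (slTwo k) M) = uMk ⁅slH k, m⁆ := by
  rw [smul_uMk, uH, UniversalEnvelopingAlgebra.lift_ι_apply, LieModule.toEnd_apply_apply]

theorem uF_smul_uMk (m : M) : uF k • (uMk m : uModule k (slTwo k) M) = uMk ⁅slF k, m⁆ := by
  rw [smul_uMk, uF, UniversalEnvelopingAlgebra.lift_ι_apply, LieModule.toEnd_apply_apply]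

end UModule

section TrivialModule

variable (k) in
/-- The augmentation, as a homomorphism to the trivial module. -/
def augHom : ModuleCat.of (USl k) (USl k) ⟶ trivialModule k :=
  elementHom (trivialModule k) (uMk (1 : k))

theorem lift_toEnd_trivial :
    UniversalEnvelopingAlgebra.lift k
      (LieModule.toEnd k (slTwo k) (TrivialLieModule k (slTwo k) k)) =
      (Algebra.lsmul k k (TrivialLieModule k (slTwo k) k)).comp (uAug k) := by
  apply uSl_hom_ext
  · rw [AlgHom.comp_apply, uAug, repHom_uE, map_zero, uE, UniversalEnvelopingAlgebra.lift_ι_apply]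
    exact LinearMap.ext fun m => trivial_lie_zero (slTwo k) (TrivialLieModule k (slTwo k) k) (slE k) m
  · rw [AlgHom.comp_apply, uAug, repHom_uH, map_zero, uH, UniversalEnvelopingAlgebra.lift_ι_apply]
    exact LinearMap.ext fun m => trivial_lie_zero (slTwo k) (TrivialLieModule k (slTwo k) k) (slH k) m
  · rw [AlgHom.comp_apply, uAug, repHom_uF, map_zero, uF, UniversalEnvelopingAlgebra.lift_ι_apply]
    exact LinearMap.ext fun m => trivial_lie_zero (slTwo k) (TrivialLieModule k (slTwo k) k) (slF k) m

theorem augHom_apply (x : USl k) : (augHom k).hom x = (uAug k x : k) := by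
  change UniversalEnvelopingAlgebra.lift k
      (LieModule.toEnd k (slTwo k) (TrivialLieModule k (slTwo k) k)) x (1 : k) = uAug k x
  rw [lift_toEnd_trivial]
  exact mul_one (uAug k x)

theorem augHom_eq_zero_iff (x : USl k) : (augHom k).hom x = 0 ↔ uAug k x = 0 :=
  Eq.congr_left (augHom_apply x)

theorem augHom_surjective : Function.Surjective (augHom k).hom := fun r =>
  ⟨algebraMap k _ (r : k), (augHom_apply _).trans ((uAug k).commutes (r : k))⟩

theorem koszul_exact_zero : Function.Exact (koszulOne k) (augHom k).hom := by
  intro x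
  rw [augHom_eq_zero_iff]
  constructor
  · intro h
    obtain ⟨a, b, c, rfl⟩ := mem_of_uAug_eq_zero h
    exact ⟨(a, b, c), koszulOne_apply a b c⟩
  · rintro ⟨⟨a, b, c⟩, rfl⟩
    rw [koszulOne_apply]
    simp only [uAug, map_add, map_mul, repHom_uE, repHom_uH, repHom_uF, mul_zero, add_zero]

end TrivialModule

/-! ### Ext³(k, M) as the coinvariants of M -/

section ExtThree

variable (k) in
/-- The differential `koszulOne` with its codomain restricted to its image. -/
def koszulOneRes : (USl k × USl k × USl k) →ₗ[USl k] LinearMap.ker (augHom k).hom :=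
  (koszulOne k).codRestrict _ fun x => koszul_exact_zero.apply_apply_eq_zero x

variable (k) in
/-- The second step of the Koszul resolution. -/
abbrev koszulSeqOne : ShortComplex (ModuleCat.{u} (USl k)) := (koszulOneRes k).shortComplexKer

variable (k) in
/-- The differential `koszulTwo` with its codomain restricted to its image. -/
def koszulTwoRes : (USl k × USl k × USl k) →ₗ[USl k] LinearMap.ker (koszulOneRes k) :=
  (koszulTwo k).codRestrict _ fun x => Subtype.ext (koszul_exact_one.apply_apply_eq_zero x)

variable (k) in
/-- The third step of the Koszul resolution. -/
abbrev koszulSeqTwo : ShortComplex (ModuleCat.{u} (USl k)) where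
  X₁ := ModuleCat.of (USl k) (USl k)
  X₂ := ModuleCat.of (USl k) (USl k × USl k × USl k)
  X₃ := ModuleCat.of (USl k) (LinearMap.ker (koszulOneRes k))
  f := ModuleCat.ofHom (koszulThree k)
  g := ModuleCat.ofHom (koszulTwoRes k)
  zero := by 
    apply ModuleCat.hom_ext
    refine LinearMap.ext fun x => Subtype.ext ?_
    exact koszul_exact_two.apply_apply_eq_zero x

theorem koszulSeqOne_shortExact : (koszulSeqOne k).ShortExact :=
  LinearMap.shortExact_shortComplexKer fun x => by
    obtain ⟨y, hy⟩ := (koszul_exact_zero x.1).1 x.2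
    exact ⟨y, Subtype.ext hy⟩

theorem koszulSeqTwo_shortExact : (koszulSeqTwo k).ShortExact :=
  ModuleCat.shortComplex_shortExact _
    (fun x => Iff.trans Subtype.ext_iff (koszul_exact_two x)) koszulThree_injective fun x => by
      obtain ⟨y, hy⟩ := (koszul_exact_one x.1).1 (congrArg Subtype.val x.2)
      exact ⟨y, Subtype.ext hy⟩

variable (M : Type u) [AddCommGroup M] [Module k M] [LieRingModule (slTwo k) M]
    [LieModule k (slTwo k) M]

/-- The homomorphism `U → M` of `U`-modules with a given value at `1`. -/
def homOfElement : M →ₗ[k] (ModuleCat.of (USl k) (USl k) ⟶ uModule k (slTwo k) M) where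
  toFun m := elementHom _ (uMk m)
  map_add' m n := by
    ext
    exact smul_add (1 : USl k) (uMk m : uModule k (slTwo k) M) (uMk n)
  map_smul' r m := by
    ext
    change (1 : USl k) • (uMk (r • m) : uModule k (slTwo k) M) =
      algebraMap k (USl k) r • ((1 : USl k) • (uMk m : uModule k (slTwo k) M))
    rw [one_smul, one_smul, smul_uMk, AlgHom.commutes]
    rfl

variable {M} in
theorem homOfElement_one (m : M) : (homOfElement M m).hom (1 : USl k) = uMk m :=
  one_smul (USl k) (uMk m : uModule k (slTwo k) M)

/-- The natural map from a representation `M` of `𝔰𝔩₂` to `Ext³(k, M)`. -/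
def extThree : M →ₗ[k] Ext.{u} (trivialModule k) (uModule k (slTwo k) M) 3 :=
  (kerSeq_shortExact (augHom_surjective (k := k))).extClass.precompOfLinear k _ (rfl : 1 + 2 = 3) ∘ₗ
    (koszulSeqOne_shortExact (k := k)).extClass.precompOfLinear k _ (rfl : 1 + 1 = 2) ∘ₗ
      (koszulSeqTwo_shortExact (k := k)).extClass.precompOfLinear k _ (rfl : 1 + 0 = 1) ∘ₗ
        (Ext.linearEquiv₀ (R := k)).symm.toLinearMap ∘ₗ homOfElement M

variable {M}

theorem extThree_apply (m : M) :
    extThree M m = (kerSeq_shortExact (augHom_surjective (k := k))).extClass.comp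
      ((koszulSeqOne_shortExact (k := k)).extClass.comp
        ((koszulSeqTwo_shortExact (k := k)).extClass.comp (Ext.mk₀ (homOfElement M m)) (rfl : 1 + 0 = 1))
        (rfl : 1 + 1 = 2)) (rfl : 1 + 2 = 3) := rfl

instance : Projective (ModuleCat.of (USl k) (USl k)) :=
  ModuleCat.projective_of_categoryTheory_projective _

instance : Projective (ModuleCat.of (USl k) (USl k × USl k × USl k)) :=
  ModuleCat.projective_of_categoryTheory_projective _

/-- Each of the three dimension shifts is onto, because positive-degree Ext groups out of free
modules vanish. -/
theorem extThree_surjective : 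
    Function.Surjective (extThree M : M →ₗ[k] Ext (trivialModule k) (uModule k (slTwo k) M) 3) := by
  intro z
  obtain ⟨y, rfl⟩ := Ext.contravariant_sequence_exact₃ (kerSeq_shortExact (augHom_surjective (k := k)))
    _ z (Ext.eq_zero_of_projective _) (rfl : 1 + 2 = 3)
  obtain ⟨x, rfl⟩ := Ext.contravariant_sequence_exact₃ (koszulSeqOne_shortExact (k := k))
    _ y (Ext.eq_zero_of_projective _) (rfl : 1 + 1 = 2)
  obtain ⟨w, rfl⟩ := Ext.contravariant_sequence_exact₃ (koszulSeqTwo_shortExact (k := k))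
    _ x (Ext.eq_zero_of_projective _) (rfl : 1 + 0 = 1)
  obtain ⟨g, rfl⟩ := Ext.addEquiv₀.symm.surjective w
  obtain ⟨m, hm⟩ := uMk_bijective.surjective (g.hom (1 : USl k))
  refine ⟨m, ?_⟩
  rw [eq_elementHom g, ← hm]
  rfl

/-- Evaluates g at (h, f, -e). The sign in `ha` absorbs the one in the differential, so that
restriction along the last differential has image exactly 𝔤M. -/
theorem koszulThree_comp (g : ModuleCat.of (USl k) (USl k × USl k × USl k) ⟶ uModule k (slTwo k) M)
    (a b c : M) (ha : g.hom (0, 0, 1) = -uMk a) (hb : g.hom (1, 0, 0) = uMk b)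
    (hc : g.hom (0, 1, 0) = uMk c) :
    ModuleCat.ofHom (koszulThree k) ≫ g =
      homOfElement M (⁅slE k, a⁆ + ⁅slH k, b⁆ + ⁅slF k, c⁆) := by
  have h : ((uH k, uF k, -uE k) : USl k × USl k × USl k) =
      uH k • (1, 0, 0) + uF k • (0, 1, 0) + (-uE k) • (0, 0, 1) := by simp
  refine (eq_elementHom _).trans (congrArg (elementHom _) ?_)
  change g.hom ((1 : USl k) • (uH k, uF k, -uE k)) = _
  rw [one_smul, h, map_add, map_add, map_smul, map_smul, map_smul, ha, hb, hc, neg_smul, smul_neg,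
    neg_neg, uE_smul_uMk, uH_smul_uMk, uF_smul_uMk, map_add, map_add]
  abel

/-- The two outer dimension shifts are injective, again by projectivity. So the class vanishes
exactly when the map U → M given by m extends along the last differential to U³. -/
theorem extThree_eq_zero_iff (m : M) :
    (extThree M m : Ext (trivialModule k) (uModule k (slTwo k) M) 3) = 0 ↔ ∃ a b c : M, m = ⁅slE k, a⁆ + ⁅slH k, b⁆ + ⁅slF k, c⁆ := by
  rw [extThree_apply]
  constructor
  · intro h
    obtain ⟨z, hz⟩ := Ext.contravariant_sequence_exact₁
      (kerSeq_shortExact (augHom_surjective (k := k))) _ _ _ h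
    rw [Ext.eq_zero_of_projective z, Ext.comp_zero] at hz
    obtain ⟨y, hy⟩ := Ext.contravariant_sequence_exact₁ (koszulSeqOne_shortExact (k := k)) _ _ _
      hz.symm
    rw [Ext.eq_zero_of_projective y, Ext.comp_zero] at hy
    obtain ⟨w, hw⟩ := Ext.contravariant_sequence_exact₁ (koszulSeqTwo_shortExact (k := k)) _ _ _
      hy.symm
    obtain ⟨g, rfl⟩ := Ext.addEquiv₀.symm.surjective w
    rw [Ext.addEquiv₀_symm_apply, Ext.mk₀_comp_mk₀] at hw
    have hw' := Ext.addEquiv₀.symm.injective hw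
    obtain ⟨a, ha⟩ := uMk_bijective.surjective (-g.hom (0, 0, 1))
    obtain ⟨b, hb⟩ := uMk_bijective.surjective (g.hom (1, 0, 0))
    obtain ⟨c, hc⟩ := uMk_bijective.surjective (g.hom (0, 1, 0))
    refine ⟨a, b, c, ?_⟩
    have h1 := (koszulThree_comp g a b c (by rw [ha, neg_neg]) hb.symm hc.symm).symm.trans hw'
    have h2 := congrArg (fun φ => φ.hom (1 : USl k)) h1
    dsimp only at h2
    rw [homOfElement_one, homOfElement_one] at h2
    exact (uMk_bijective.injective h2).symm
  · rintro ⟨a, b, c, rfl⟩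
    let g : ModuleCat.of (USl k) (USl k × USl k × USl k) ⟶ uModule k (slTwo k) M :=
      elementHomThree _ (uMk b) (uMk c) (-uMk a)
    have hg := koszulThree_comp g a b c (elementHomThree_basis _ _ _).2.2
      (elementHomThree_basis _ _ _).1 (elementHomThree_basis _ _ _).2.1
    rw [← hg, ← Ext.mk₀_comp_mk₀, ShortComplex.ShortExact.extClass_comp_assoc, Ext.comp_zero,
      Ext.comp_zero]

/-- Naturality: on Ext³ the map induced by f is the one induced on coinvariants. It is applied to
multiplication by c. -/
theorem extThree_comp {N : Type u} [AddCommGroup N] [Module k N] [LieRingModule (slTwo k) N]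
    [LieModule k (slTwo k) N] (f : M →ₗ⁅k,slTwo k⁆ N) (m : M) :
    (extThree M m : Ext (trivialModule k) (uModule k (slTwo k) M) 3).comp (Ext.mk₀ (uMap f)) (add_zero 3) = extThree N (f m) := by
  have h : homOfElement M m ≫ uMap f = homOfElement N (f m) := by
    ext
    exact (map_smul (uMap f).hom (1 : USl k) (uMk m))
  simp only [extThree_apply]
  rw [Ext.comp_assoc_of_third_deg_zero, Ext.comp_assoc_of_third_deg_zero,
    Ext.comp_assoc_of_third_deg_zero, Ext.mk₀_comp_mk₀, h]

end ExtThree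

end Koszul

/-! ### Functionals on Sⁿ killing 𝔤Sⁿ, as solutions of recurrences -/

section InvariantFunctionals

variable {k : Type u} [Field k]

/-- The conditions on the values `μ i l j` at the monomials `eⁱhˡfʲ` of a linear functional on `Sⁿ`
that make it vanish on `𝔤Sⁿ`. -/
structure IsInv (n : ℕ) (μ : ℕ → ℕ → ℕ → k) : Prop where
  weight : ∀ i l j, i + l + j = n → (i - j : k) * μ i l j = 0
  step : ∀ i l j, i + l + j + 2 = n → (j + 1 : k) * μ i (l + 2) j = 2 * (l + 1) * μ (i + 1) l (j + 1)
  one : ∀ i j, i + 1 + j = n → (j + 1 : k) * μ i 1 j = 0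
  left : ∀ i l, i + 1 + l = n → (l + 1 : k) * μ (i + 1) l 0 = 0
  right : ∀ l j, l + (j + 1) = n → (l + 1 : k) * μ 0 l (j + 1) = 0

/-- A lift of an invariant functional along multiplication by the Casimir element, up to a scalar. -/
def liftFun (μ : ℕ → ℕ → ℕ → k) : ℕ → ℕ → ℕ → k
  | i, l + 2, j => (l + 1) * μ i l j
  | i + 1, 0, j + 1 => (j + 1) / 2 * μ i 0 j
  | _, _, _ => 0

/-- The invariant operator Δ = ∂ₕ² + ∂ₑ∂_f is dual to c, so μ∘Δ is again invariant. For invariant μ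
it equals (m + 2) · `liftFun μ`; removing that factor gives a formula that still works when m + 2 =
0 in k. Composing `liftFun μ` with multiplication by c yields (m + 3)μ. -/
theorem IsInv.exists_lift_of_ne_zero (h2 : (2 : k) ≠ 0) {m : ℕ} (hm : (m + 3 : k) ≠ 0)
    {μ : ℕ → ℕ → ℕ → k} (h : IsInv m μ) :
    ∃ ν : ℕ → ℕ → ℕ → k, IsInv (m + 2) ν ∧
      ∀ i l j, i + l + j = m → ν i (l + 2) j + 4 * ν (i + 1) l (j + 1) = μ i l j := by
  have hL : IsInv (m + 2) (liftFun μ) := by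
    refine ⟨?_, ?_, ?_, ?_, ?_⟩
    · intro i l j hn
      rcases l with _ | _ | l
      · rcases i with _ | i
        · simp [liftFun]
        rcases j with _ | j
        · simp [liftFun]
        have := h.weight i 0 j (by omega)
        simp only [liftFun]
        push_cast
        linear_combination (j + 1) / 2 * this
      · rcases i <;> simp [liftFun]
      · have := h.weight i l j (by omega)
        simp only [liftFun]
        linear_combination (l + 1 : k) * this
    · intro i l j hn
      rcases l with _ | _ | l
      · simp only [liftFun]
        push_cast
        field_simp
      · have := h.one i j (by omega)
        simp only [liftFun]
        push_cast
        linear_combination 2 * this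
      · have := h.step i l j (by omega)
        simp only [liftFun]
        push_cast
        linear_combination (l + 3 : k) * this
    · intro i j hn
      rcases i <;> simp [liftFun]
    · intro i l hn
      rcases l with _ | _ | l
      · simp [liftFun]
      · simp [liftFun]
      · have := h.left i l (by omega)
        simp only [liftFun]
        push_cast
        linear_combination (l + 3 : k) * this
    · intro l j hn
      rcases l with _ | _ | l
      · simp [liftFun]
      · simp [liftFun]
      · have := h.right l j (by omega)
        simp only [liftFun]
        push_cast
        linear_combination (l + 3 : k) * this
  refine ⟨fun i l j => (m + 3 : k)⁻¹ * liftFun μ i l j, ?_, ?_⟩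
  · refine ⟨fun i l j hn => ?_, fun i l j hn => ?_, fun i j hn => ?_, fun i l hn => ?_,
      fun l j hn => ?_⟩
    · linear_combination (m + 3 : k)⁻¹ * hL.weight i l j hn
    · linear_combination (m + 3 : k)⁻¹ * hL.step i l j hn
    · linear_combination (m + 3 : k)⁻¹ * hL.one i j hn
    · linear_combination (m + 3 : k)⁻¹ * hL.left i l hn
    · linear_combination (m + 3 : k)⁻¹ * hL.right l j hn
  · intro i l j hn
    have key : liftFun μ i (l + 2) j + 4 * liftFun μ (i + 1) l (j + 1) = (m + 3) * μ i l j := by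
      have hw := h.weight i l j hn
      have hc : (i + l + j : k) = m := by exact_mod_cast congrArg (Nat.cast : ℕ → k) hn
      rcases l with _ | _ | l
      · simp only [liftFun]
        push_cast at hc ⊢
        field_simp
        rw [← hc]
        linear_combination -2 * hw
      · have := h.one i j hn
        simp only [liftFun]
        push_cast at hc ⊢
        rw [← hc]
        simp only [zero_add] at hw this ⊢
        linear_combination -hw - 2 * this
      · have := h.step i l j (by omega)
        simp only [liftFun]
        push_cast at hc ⊢
        rw [← hc]
        linear_combination -2 * this - hw
    field_simp
    linear_combination key

/-- The solution of `ν i (l + 2) j + 4 * ν (i + 1) l (j + 1) = μ i l j` that vanishes for `l < 2`. -/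
def descentFun (μ : ℕ → ℕ → ℕ → k) : ℕ → ℕ → ℕ → k
  | i, l + 2, j => μ i l j - 4 * descentFun μ (i + 1) l (j + 1)
  | _, _, _ => 0
termination_by _ l _ => l

theorem descentFun_add_two (μ : ℕ → ℕ → ℕ → k) (i l j : ℕ) :
    descentFun μ i (l + 2) j = μ i l j - 4 * descentFun μ (i + 1) l (j + 1) := by
  rw [descentFun]

theorem descentFun_one (μ : ℕ → ℕ → ℕ → k) (i j : ℕ) : descentFun μ i 1 j = 0 := by
  rw [descentFun]
  simp

theorem descentFun_zero (μ : ℕ → ℕ → ℕ → k) (i j : ℕ) : descentFun μ i 0 j = 0 := by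
  rw [descentFun]
  simp

/-- The descent replaces (i, j) by (i + 1, j + 1), which preserves i - j. -/
theorem descentFun_weight {m : ℕ} {μ : ℕ → ℕ → ℕ → k} (h : IsInv m μ) (l : ℕ) :
    ∀ i j, i + l + j = m + 2 → (i - j : k) * descentFun μ i l j = 0 := by
  induction l using Nat.twoStepInduction with
  | zero => intro i j _; rw [descentFun_zero, mul_zero]
  | one => intro i j _; rw [descentFun_one, mul_zero]
  | more l ih _ =>
    intro i j hn
    have h1 := ih (i + 1) (j + 1) (by omega)
    have h2 := h.weight i l j (by omega)
    rw [descentFun_add_two]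
    push_cast at h1
    linear_combination h2 - 4 * h1

/-! ### The degenerate degrees, where m + 3 = 0 in k -/

section Degenerate

variable {m : ℕ} (hm : (m + 3 : k) = 0) {μ : ℕ → ℕ → ℕ → k} (h : IsInv m μ)
include hm h

/-- The weight condition allows i to be replaced by j, and then l = -5 - 2j in k, so 2(l + 1) = -4(j
+ 2). Hence (-4)ʲ(j + 1) μ(i, l, j) is constant along each line where i - j is fixed, and its value
can be read at an end of the line. -/
theorem IsInv.step' {i l j : ℕ} (hn : i + l + j + 2 = m) :
    (j + 1 : k) * μ i (l + 2) j = -4 * ((j + 1 + 1) * μ (i + 1) l (j + 1)) := by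
  have h1 := h.step i l j hn
  have h2 := h.weight (i + 1) l (j + 1) (by omega)
  have hc : (i + l + j + 2 : k) = m := by exact_mod_cast congrArg (Nat.cast : ℕ → k) hn
  push_cast at h2
  linear_combination h1 - 2 * h2 + 2 * μ (i + 1) l (j + 1) * hc + 2 * μ (i + 1) l (j + 1) * hm

/-- On a line with i > j the end is j = 0. There the conditions `left` and `weight` add up to (m +
1)μ = -2μ = 0, and `step'` propagates the vanishing. -/
theorem IsInv.succ_mul_eq_zero_of_lt (h2 : (2 : k) ≠ 0) (j : ℕ) :
    ∀ d l, d + 1 + j + l + j = m → (j + 1 : k) * μ (d + 1 + j) l j = 0 := by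
  have h4 : (-4 : k) ≠ 0 := by
    rw [neg_ne_zero]
    convert mul_ne_zero h2 h2 using 1
    norm_num
  induction j with
  | zero =>
    intro d l hn
    have h1 := h.left d l (by omega)
    have hw := h.weight (d + 1) l 0 (by omega)
    have hc : (d + 1 + l : k) = m := by exact_mod_cast congrArg (Nat.cast : ℕ → k) hn
    have h3 : (-2 : k) * μ (d + 1) l 0 = 0 := by
      push_cast at hw
      linear_combination h1 + hw - μ (d + 1) l 0 * hc - μ (d + 1) l 0 * hm
    rw [add_zero, (mul_eq_zero.1 h3).resolve_left (neg_ne_zero.2 h2), mul_zero]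
  | succ j ih =>
    intro d l hn
    have h1 := ih d (l + 2) (by omega)
    rw [h.step' hm (by omega)] at h1
    have h3 := (mul_eq_zero.1 h1).resolve_left h4
    push_cast
    exact h3

theorem IsInv.succ_mul_eq_zero_of_gt (h2 : (2 : k) ≠ 0) (i : ℕ) :
    ∀ d l, i + l + (d + 1 + i) = m → ((d + 1 + i : ℕ) + 1 : k) * μ i l (d + 1 + i) = 0 := by
  have h4 : (-4 : k) ≠ 0 := by
    rw [neg_ne_zero]
    convert mul_ne_zero h2 h2 using 1
    norm_num
  induction i with
  | zero =>
    intro d l hn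
    have h1 := h.right l d (by omega)
    have hw := h.weight 0 l (d + 1) (by omega)
    have hc : (l + (d + 1) : k) = m := by
      have := congrArg (Nat.cast : ℕ → k) hn
      push_cast at this
      linear_combination this
    have h3 : (-2 : k) * μ 0 l (d + 1) = 0 := by
      push_cast at hw
      linear_combination h1 - hw - μ 0 l (d + 1) * hc - μ 0 l (d + 1) * hm
    rw [add_zero, (mul_eq_zero.1 h3).resolve_left (neg_ne_zero.2 h2), mul_zero]
  | succ i ih =>
    intro d l hn
    have h1 := ih d (l + 2) (by omega)
    rw [h.step' hm (by omega)] at h1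
    have h3 := (mul_eq_zero.1 h1).resolve_left h4
    have e : d + 1 + (i + 1) = d + 1 + i + 1 := by omega
    rw [e]
    push_cast at h3 ⊢
    exact h3

theorem IsInv.succ_mul_diag (j : ℕ) :
    ∀ l, j + l + j = m → (-4 : k) ^ j * ((j + 1 : k) * μ j l j) = μ 0 m 0 := by
  induction j with
  | zero => intro l hn; simp [← hn]
  | succ j ih =>
    intro l hn
    have h1 := ih (l + 2) (by omega)
    rw [h.step' hm (by omega)] at h1
    rw [← h1, pow_succ]
    push_cast
    ring

theorem IsInv.exists_lift_of_eq_zero (p : ℕ) [CharP k p] (hp : p.Prime) (hp2 : 2 < p)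
    (h2 : (2 : k) ≠ 0) (hmp : m + 3 ≠ p) :
    ∃ ν : ℕ → ℕ → ℕ → k, IsInv (m + 2) ν ∧
      ∀ i l j, i + l + j = m → ν i (l + 2) j + 4 * ν (i + 1) l (j + 1) = μ i l j := by
  have h4 : (-4 : k) ≠ 0 := by
    rw [neg_ne_zero]
    convert mul_ne_zero h2 h2 using 1
    norm_num
  -- The constant of the diagonal line is computed at its other points. If m is even, m + 3 is an
  -- odd multiple of p other than p, so the diagonal is long enough to contain j = p - 1, where the
  -- factor j + 1 vanishes. If m is odd, it ends at l = 1, where the condition `one` applies.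
  have h0 : μ 0 m 0 = 0 := by
    have hodd : p % 2 = 1 := Nat.odd_iff.1 (hp.odd_of_ne_two (by omega))
    rcases Nat.even_or_odd' m with ⟨q, hq | hq⟩
    · have hdvd : p ∣ m + 3 := by
        rw [← CharP.cast_eq_zero_iff k p]
        exact_mod_cast hm
      obtain ⟨t, ht⟩ := hdvd
      have ht3 : 3 ≤ t := by
        by_contra hlt
        interval_cases t <;> omega
      have hle : p * 3 ≤ p * t := Nat.mul_le_mul_left p ht3
      have h1 := h.succ_mul_diag hm (p - 1) (m - 2 * (p - 1)) (by omega)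
      have hp1 : ((p - 1 : ℕ) + 1 : k) = 0 := by
        have : ((p - 1 + 1 : ℕ) : k) = 0 := by
          rw [Nat.sub_add_cancel (by omega), CharP.cast_eq_zero]
        exact_mod_cast this
      rw [hp1, zero_mul, mul_zero] at h1
      exact h1.symm
    · have h1 := h.succ_mul_diag hm q 1 (by omega)
      rw [h.one q q (by omega), mul_zero] at h1
      exact h1.symm
  have hν : ∀ i l j, i + l + j = m → (j + 1 : k) * μ i l j = 0 := by
    intro i l j hn
    rcases lt_trichotomy i j with hij | rfl | hij
    · obtain ⟨d, rfl⟩ : ∃ d, j = d + 1 + i := ⟨j - i - 1, by omega⟩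
      exact h.succ_mul_eq_zero_of_gt hm h2 i d l hn
    · have h1 := h.succ_mul_diag hm i l hn
      rw [h0] at h1
      exact (mul_eq_zero.1 h1).resolve_left (pow_ne_zero _ h4)
    · obtain ⟨d, rfl⟩ : ∃ d, i = d + 1 + j := ⟨i - j - 1, by omega⟩
      exact h.succ_mul_eq_zero_of_lt hm h2 j d l hn
  -- By `hν` the μ-term drops out of the recurrence, and the remaining coefficients become multiples
  -- of m + 3 = 0 once the weight condition is used.
  refine ⟨descentFun μ, ⟨fun i l j => descentFun_weight h l i j, ?_, ?_, ?_, ?_⟩, ?_⟩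
  · intro i l j hn
    have h1 := hν i l j (by omega)
    have hw := descentFun_weight h l (i + 1) (j + 1) (by omega)
    have hc : (i + l + j : k) = m := by
      exact_mod_cast congrArg (Nat.cast : ℕ → k) (show i + l + j = m by omega)
    rw [descentFun_add_two]
    push_cast at hw
    linear_combination h1 + 2 * hw - 2 * descentFun μ (i + 1) l (j + 1) * hc -
      2 * descentFun μ (i + 1) l (j + 1) * hm
  · intro i j _
    rw [descentFun_one, mul_zero]
  · intro i l hn
    have hw := descentFun_weight h l (i + 1) 0 (by omega)
    have hc : (i + 1 + l : k) = m + 2 := by exact_mod_cast congrArg (Nat.cast : ℕ → k) hn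
    push_cast at hw
    linear_combination -hw + descentFun μ (i + 1) l 0 * hc + descentFun μ (i + 1) l 0 * hm
  · intro l j hn
    have hw := descentFun_weight h l 0 (j + 1) (by omega)
    have hc : (l + (j + 1) : k) = m + 2 := by exact_mod_cast congrArg (Nat.cast : ℕ → k) hn
    push_cast at hw
    linear_combination hw + descentFun μ 0 l (j + 1) * hc + descentFun μ 0 l (j + 1) * hm
  · intro i l j _
    rw [descentFun_add_two]
    ring

end Degenerate

/-- The invariant functional on `Sᵖ⁻³`. -/
theorem isInv_diag (p : ℕ) [CharP k p] (hp : p.Prime) (hp2 : 2 < p) (h2 : (2 : k) ≠ 0) :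
    IsInv (p - 3) (fun i _ j => if i = j then ((-4 : k) ^ j * (j + 1))⁻¹ else 0) := by
  have h4 : (-4 : k) ≠ 0 := by
    rw [neg_ne_zero]
    convert mul_ne_zero h2 h2 using 1
    norm_num
  have hne : ∀ j : ℕ, j + 1 < p → (j + 1 : k) ≠ 0 := by
    intro j hj h
    have h' : ((j + 1 : ℕ) : k) = 0 := by exact_mod_cast h
    rw [CharP.cast_eq_zero_iff k p] at h'
    exact absurd (Nat.le_of_dvd (by omega) h') (by omega)
  refine ⟨?_, ?_, ?_, ?_, ?_⟩
  · intro i l j hn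
    by_cases hij : i = j <;> simp [hij]
  · intro i l j hn
    by_cases hij : i = j
    · subst hij
      have h1 := hne i (by omega)
      have h1' := hne (i + 1) (by omega)
      -- Since 2i + l + 5 = p, the coefficient 2(l + 1) equals -4(i + 2); the chosen values make
      -- (-4)ʲ(j + 1)μ constantly 1 on the diagonal.
      have hc : (i + l + i + 5 : k) = 0 := by
        have h3 : i + l + i + 5 = p := by omega
        rw [← CharP.cast_eq_zero k p, ← h3]
        push_cast
        ring
      push_cast at h1' ⊢
      simp only [if_true]
      have hpow := pow_ne_zero i h4
      rw [pow_succ, show (2 : k) * (l + 1) = -4 * (i + 1 + 1) by linear_combination 2 * hc]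
      generalize (-4 : k) = z at h4 hpow ⊢
      field_simp
    · simp [hij]
  · intro i j hn
    -- As p - 3 is even, i + 1 + j = p - 3 excludes i = j.
    have hodd : p % 2 = 1 := Nat.odd_iff.1 (hp.odd_of_ne_two (by omega))
    have hij : i ≠ j := by omega
    simp [hij]
  · intro i l hn
    simp
  · intro l j hn
    simp

end InvariantFunctionals

/-! ### Monomial bases of the two symmetric algebras -/

section Polynomials

variable {k : Type u} [Field k] {M : Type v} [AddCommGroup M] [Module k M] {κ : Type*}

/-- The symmetric algebra of a vector space with a basis is a polynomial algebra. -/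
def symAlgEquiv (b : Module.Basis κ k M) : SymAlg k M ≃ₐ[k] MvPolynomial κ k :=
  SymmetricAlgebra.equivMvPolynomial b

theorem symAlgEquiv_ι (b : Module.Basis κ k M) (i : κ) :
    symAlgEquiv b (SymAlg.ι k M (b i)) = MvPolynomial.X i :=
  SymmetricAlgebra.equivMvPolynomial_ι_apply b i

instance : IsDomain (SymAlg k M) := inferInstanceAs (IsDomain (SymmetricAlgebra k M))

variable (k) in
/-- The basis `e, h, f` of `𝔰𝔩₂(k)`. -/
def slTwoBasis : Module.Basis (Fin 3) k (slTwo k) :=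
  Module.Basis.ofEquivFun
    { toFun := fun A => ![A.1 0 1, A.1 0 0, A.1 1 0]
      invFun := fun v => v 0 • slE k + v 1 • slH k + v 2 • slF k
      map_add' := fun A B => by
        ext i
        fin_cases i <;> rfl
      map_smul' := fun r A => by
        ext i
        fin_cases i <;> rfl
      left_inv := fun A => (slTwo_eq A).symm
      right_inv := fun v => by
        ext i
        fin_cases i
        · change v 0 * (slE k).1 0 1 + v 1 * (slH k).1 0 1 + v 2 * (slF k).1 0 1 = v 0
          simp [slE, slH, slF]
        · change v 0 * (slE k).1 0 0 + v 1 * (slH k).1 0 0 + v 2 * (slF k).1 0 0 = v 1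
          simp [slE, slH, slF]
        · change v 0 * (slE k).1 1 0 + v 1 * (slH k).1 1 0 + v 2 * (slF k).1 1 0 = v 2
          simp [slE, slH, slF] }

theorem slTwoBasis_apply :
    slTwoBasis k 0 = slE k ∧ slTwoBasis k 1 = slH k ∧ slTwoBasis k 2 = slF k := by
  have h : ∀ i, slTwoBasis k i = (Pi.single i 1 : Fin 3 → k) 0 • slE k +
      (Pi.single i 1 : Fin 3 → k) 1 • slH k + (Pi.single i 1 : Fin 3 → k) 2 • slF k := fun i => by
    rw [slTwoBasis, Module.Basis.coe_ofEquivFun]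
    rfl
  simp [h]

variable (k) in
/-- The basis `x, y` of `L(1)`. -/
def natRepBasis : Module.Basis (Fin 2) k (NatRep k) :=
  (Pi.basisFun k (Fin 2) : Module.Basis (Fin 2) k (Fin 2 → k))

theorem natRepBasis_apply : natRepBasis k 0 = vecX k ∧ natRepBasis k 1 = vecY k := by
  constructor
  · refine (Pi.basisFun_apply k (Fin 2) 0).trans ?_
    change Pi.single 0 1 = (![1, 0] : Fin 2 → k)
    ext i
    fin_cases i <;> simp
  · refine (Pi.basisFun_apply k (Fin 2) 1).trans ?_
    change Pi.single 1 1 = (![0, 1] : Fin 2 → k)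
    ext i
    fin_cases i <;> simp

variable (k) in
/-- The monomial `eⁱhˡfʲ` of the symmetric algebra. -/
def mon (i l j : ℕ) : SAd k :=
  SymAlg.ι k _ (slE k) ^ i * SymAlg.ι k _ (slH k) ^ l * SymAlg.ι k _ (slF k) ^ j

theorem mon_mem (i l j : ℕ) : mon k i l j ∈ symPow k (slTwo k) (slTwo k) (i + l + j) := by
  rw [mem_symPow, pow_add, pow_add]
  exact Submodule.mul_mem_mul (Submodule.mul_mem_mul
    (Submodule.pow_mem_pow _ (LinearMap.mem_range_self _ _) _)
    (Submodule.pow_mem_pow _ (LinearMap.mem_range_self _ _) _))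
    (Submodule.pow_mem_pow _ (LinearMap.mem_range_self _ _) _)

/-- `Sⁿ` is spanned by monomials. -/
theorem symPow_le_of_mon {n : ℕ} {V : Submodule k (SAd k)}
    (h : ∀ i l j, i + l + j = n → mon k i l j ∈ V) {s : SAd k}
    (hs : s ∈ symPow k (slTwo k) (slTwo k) n) : s ∈ V := by
  have key : s ∈ Submodule.span k {t | ∃ i l j, i + l + j = n ∧ mon k i l j = t} := by
    rw [mem_symPow] at hs
    clear h
    induction hs using Submodule.pow_induction_on_left' with
    | algebraMap r =>
      rw [Algebra.algebraMap_eq_smul_one]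
      exact Submodule.smul_mem _ _ (Submodule.subset_span ⟨0, 0, 0, rfl, by simp [mon]⟩)
    | add a b i ha hb iha ihb => exact Submodule.add_mem _ iha ihb
    | mem_mul m hm n a ha iha =>
      obtain ⟨A, rfl⟩ := hm
      rw [slTwo_eq A]
      simp only [map_add, map_smul, add_mul, smul_mul_assoc]
      have hX : ∀ X : SAd k, (∀ i l j, i + l + j = n → ∃ i' l' j', i' + l' + j' = n.succ ∧
          mon k i' l' j' = X * mon k i l j) →
          X * a ∈ Submodule.span k {t | ∃ i l j, i + l + j = n.succ ∧ mon k i l j = t} := by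
        intro X hX
        have hle : Submodule.span k {t | ∃ i l j, i + l + j = n ∧ mon k i l j = t} ≤
            (Submodule.span k {t | ∃ i l j, i + l + j = n.succ ∧ mon k i l j = t}).comap
              (LinearMap.mulLeft k X) := by
          rw [Submodule.span_le]
          rintro _ ⟨i, l, j, hn, rfl⟩
          exact Submodule.subset_span (hX i l j hn)
        exact hle iha
      refine Submodule.add_mem _ (Submodule.add_mem _ ?_ ?_) ?_ <;>
        refine Submodule.smul_mem _ _ (hX _ fun i l j hn => ?_)
      · exact ⟨i + 1, l, j, by omega, by simp only [mon]; ring⟩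
      · exact ⟨i, l + 1, j, by omega, by simp only [mon]; ring⟩
      · exact ⟨i, l, j + 1, by omega, by simp only [mon]; ring⟩
  refine Submodule.span_le.2 ?_ key
  rintro _ ⟨i, l, j, hn, rfl⟩
  exact h i l j hn

/-- The linear map on the symmetric algebra with given values on monomials. -/
theorem exists_linearMap_mon {V : Type*} [AddCommGroup V] [Module k V] (ν : ℕ → ℕ → ℕ → V) :
    ∃ L : SAd k →ₗ[k] V, ∀ i l j, L (mon k i l j) = ν i l j := by
  refine ⟨(MvPolynomial.basisMonomials (Fin 3) k).constr k (fun s => ν (s 0) (s 1) (s 2)) ∘ₗ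
    (symAlgEquiv (slTwoBasis k)).toLinearMap, fun i l j => ?_⟩
  obtain ⟨he, hh, hf⟩ := slTwoBasis_apply (k := k)
  have h : symAlgEquiv (slTwoBasis k) (mon k i l j) = MvPolynomial.basisMonomials (Fin 3) k
      (Finsupp.single 0 i + Finsupp.single 1 l + Finsupp.single 2 j) := by
    rw [mon, ← he, ← hh, ← hf, map_mul, map_mul, map_pow, map_pow, map_pow, symAlgEquiv_ι,
      symAlgEquiv_ι, symAlgEquiv_ι, MvPolynomial.coe_basisMonomials, MvPolynomial.X_pow_eq_monomial,
      MvPolynomial.X_pow_eq_monomial, MvPolynomial.X_pow_eq_monomial, MvPolynomial.monomial_mul,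
      MvPolynomial.monomial_mul, one_mul, one_mul]
  rw [LinearMap.comp_apply, AlgEquiv.toLinearMap_apply, h, Module.Basis.constr_basis]
  simp

/-- The linear map on the symmetric algebra of `L(1)` with given values on monomials. -/
theorem exists_linearMap_nat {V : Type*} [AddCommGroup V] [Module k V] (ν : ℕ → ℕ → V) :
    ∃ L : SNat k →ₗ[k] V, ∀ a b, L (natX k ^ a * natY k ^ b) = ν a b := by
  refine ⟨(MvPolynomial.basisMonomials (Fin 2) k).constr k (fun s => ν (s 0) (s 1)) ∘ₗ
    (symAlgEquiv (natRepBasis k)).toLinearMap, fun a b => ?_⟩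
  obtain ⟨hx, hy⟩ := natRepBasis_apply (k := k)
  have h : symAlgEquiv (natRepBasis k) (natX k ^ a * natY k ^ b) =
      MvPolynomial.basisMonomials (Fin 2) k (Finsupp.single 0 a + Finsupp.single 1 b) := by
    rw [natX, natY, ← hx, ← hy, map_mul, map_pow, map_pow, symAlgEquiv_ι, symAlgEquiv_ι,
      MvPolynomial.coe_basisMonomials, MvPolynomial.X_pow_eq_monomial,
      MvPolynomial.X_pow_eq_monomial, MvPolynomial.monomial_mul, one_mul]
  rw [LinearMap.comp_apply, AlgEquiv.toLinearMap_apply, h, Module.Basis.constr_basis]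
  simp

/-- `Sⁿ(L(1))` is spanned by monomials. -/
theorem symPow_nat_le {n : ℕ} {V : Submodule k (SNat k)}
    (h : ∀ a b, a + b = n → natX k ^ a * natY k ^ b ∈ V) {s : SNat k}
    (hs : s ∈ symPow k (NatRep k) (slTwo k) n) : s ∈ V := by
  have key : s ∈ Submodule.span k {t | ∃ a b, a + b = n ∧ natX k ^ a * natY k ^ b = t} := by
    rw [mem_symPow] at hs
    clear h
    induction hs using Submodule.pow_induction_on_left' with
    | algebraMap r =>
      rw [Algebra.algebraMap_eq_smul_one]
      exact Submodule.smul_mem _ _ (Submodule.subset_span ⟨0, 0, rfl, by simp⟩)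
    | add a b i ha hb iha ihb => exact Submodule.add_mem _ iha ihb
    | mem_mul m hm n a ha iha =>
      obtain ⟨A, rfl⟩ := hm
      obtain ⟨hx, hy⟩ := natRepBasis_apply (k := k)
      rw [← (natRepBasis k).sum_repr A, Fin.sum_univ_two, hx, hy]
      simp only [map_add, map_smul, add_mul, smul_mul_assoc]
      have hX : ∀ X : SNat k, (∀ i j, i + j = n → ∃ i' j', i' + j' = n.succ ∧
          natX k ^ i' * natY k ^ j' = X * (natX k ^ i * natY k ^ j)) →
          X * a ∈ Submodule.span k {t | ∃ a b, a + b = n.succ ∧ natX k ^ a * natY k ^ b = t} := by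
        intro X hX
        have hle : Submodule.span k {t | ∃ a b, a + b = n ∧ natX k ^ a * natY k ^ b = t} ≤
            (Submodule.span k {t | ∃ a b, a + b = n.succ ∧ natX k ^ a * natY k ^ b = t}).comap
              (LinearMap.mulLeft k X) := by
          rw [Submodule.span_le]
          rintro _ ⟨i, j, hn, rfl⟩
          exact Submodule.subset_span (hX i j hn)
        exact hle iha
      refine Submodule.add_mem _ ?_ ?_ <;>
        refine Submodule.smul_mem _ _ (hX _ fun i j hn => ?_)
      · exact ⟨i + 1, j, by omega, by rw [pow_succ', mul_assoc]; rfl⟩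
      · exact ⟨i, j + 1, by omega, by rw [pow_succ', mul_left_comm]; rfl⟩
  refine Submodule.span_le.2 ?_ key
  rintro _ ⟨a, b, hn, rfl⟩
  exact h a b hn

theorem casimir_mul_mon (i l j : ℕ) :
    casimir k * mon k i l j = mon k i (l + 2) j + (4 : k) • mon k (i + 1) l (j + 1) := by
  rw [casimir, Algebra.smul_def, map_ofNat]
  simp only [mon]
  ring

/-! ### The adjoint action on monomials -/

section Brackets

/-- The derivation rule with [e, h] = -2e and [e, f] = h. A truncated exponent occurs only with
coefficient zero. -/
theorem slE_lie_mon (i l j : ℕ) :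
    ⁅slE k, mon k i l j⁆ = (j : k) • mon k i (l + 1) (j - 1) -
      (2 * l : k) • mon k (i + 1) (l - 1) j := by
  have h1 : ⁅slE k, slH k⁆ = -((2 : k) • slE k) := by rw [← lie_skew, slH_lie_slE]
  rw [sym_lie_def, mon]
  simp only [Derivation.leibniz, Derivation.leibniz_pow, symDer_ι, LieModule.toEnd_apply_apply,
    lie_self, h1, slE_lie_slF, map_zero, map_neg, map_smul, smul_eq_mul, mul_zero,
    mon, Algebra.smul_def, map_mul, map_ofNat, map_natCast]
  rcases l with _ | l <;> rcases j with _ | j <;> simp <;> ring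

theorem slH_lie_mon (i l j : ℕ) :
    ⁅slH k, mon k i l j⁆ = (2 * (i - j) : k) • mon k i l j := by
  rw [sym_lie_def, mon]
  simp only [Derivation.leibniz, Derivation.leibniz_pow, symDer_ι, LieModule.toEnd_apply_apply,
    lie_self, slH_lie_slE, slH_lie_slF, map_zero, map_neg, map_smul, smul_eq_mul, mul_zero,
    zero_add, Algebra.smul_def, map_mul, map_sub, map_ofNat, map_natCast]
  rcases i with _ | i <;> rcases j with _ | j <;> simp <;> ring

theorem slF_lie_mon (i l j : ℕ) :
    ⁅slF k, mon k i l j⁆ = (2 * l : k) • mon k i (l - 1) (j + 1) -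
      (i : k) • mon k (i - 1) (l + 1) j := by
  have h1 : ⁅slF k, slH k⁆ = (2 : k) • slF k := by rw [← lie_skew, slH_lie_slF, neg_neg]
  have h2 : ⁅slF k, slE k⁆ = -slH k := by rw [← lie_skew, slE_lie_slF]
  rw [sym_lie_def, mon]
  simp only [Derivation.leibniz, Derivation.leibniz_pow, symDer_ι, LieModule.toEnd_apply_apply,
    lie_self, h1, h2, map_zero, map_neg, map_smul, smul_eq_mul, mul_zero,
    zero_add, mon, Algebra.smul_def, map_mul, map_ofNat, map_natCast]
  rcases l with _ | l <;> rcases i with _ | i <;> simp <;> ring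

end Brackets

end Polynomials

/-! ### Coinvariants of symmetric powers and multiplication by c -/

section Coinvariants

variable {k : Type u} [Field k]

variable (k) in
/-- The subspace `𝔤Sⁿ` of `Sⁿ`. -/
def brackets (n : ℕ) : Submodule k (SAd k) :=
  (symPow k (slTwo k) (slTwo k) n).toSubmodule.map (LieModule.toEnd k (slTwo k) (SAd k) (slE k)) ⊔
    (symPow k (slTwo k) (slTwo k) n).toSubmodule.map
      (LieModule.toEnd k (slTwo k) (SAd k) (slH k)) ⊔
    (symPow k (slTwo k) (slTwo k) n).toSubmodule.map (LieModule.toEnd k (slTwo k) (SAd k) (slF k))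

theorem slE_lie_mem_brackets {n : ℕ} {s : SAd k} (hs : s ∈ symPow k (slTwo k) (slTwo k) n) :
    ⁅slE k, s⁆ ∈ brackets k n :=
  Submodule.mem_sup_left (Submodule.mem_sup_left (Submodule.mem_map_of_mem hs))

theorem slH_lie_mem_brackets {n : ℕ} {s : SAd k} (hs : s ∈ symPow k (slTwo k) (slTwo k) n) :
    ⁅slH k, s⁆ ∈ brackets k n :=
  Submodule.mem_sup_left (Submodule.mem_sup_right (Submodule.mem_map_of_mem hs))

theorem slF_lie_mem_brackets {n : ℕ} {s : SAd k} (hs : s ∈ symPow k (slTwo k) (slTwo k) n) :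
    ⁅slF k, s⁆ ∈ brackets k n :=
  Submodule.mem_sup_right (Submodule.mem_map_of_mem hs)

theorem mem_brackets_iff {n : ℕ} (s : symPow k (slTwo k) (slTwo k) n) :
    s.1 ∈ brackets k n ↔ ∃ a b c : symPow k (slTwo k) (slTwo k) n,
      s = ⁅slE k, a⁆ + ⁅slH k, b⁆ + ⁅slF k, c⁆ := by
  constructor
  · intro h
    obtain ⟨_, hy, _, ⟨c, hc, rfl⟩, h⟩ := Submodule.mem_sup.1 h
    obtain ⟨_, ⟨a, ha, rfl⟩, _, ⟨b, hb, rfl⟩, rfl⟩ := Submodule.mem_sup.1 hy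
    exact ⟨⟨a, ha⟩, ⟨b, hb⟩, ⟨c, hc⟩, Subtype.ext h.symm⟩
  · rintro ⟨a, b, c, rfl⟩
    exact Submodule.add_mem _ (Submodule.add_mem _ (slE_lie_mem_brackets a.2)
      (slH_lie_mem_brackets b.2)) (slF_lie_mem_brackets c.2)

theorem mon_mem' {i l j n : ℕ} (h : i + l + j = n) :
    mon k i l j ∈ symPow k (slTwo k) (slTwo k) n := h ▸ mon_mem i l j

/-- The bracket with h gives the weight condition, those with e give `step`, `one` and `left`, and
those with f on monomials without e give `right`. -/
theorem isInv_of_brackets_le_ker (h2 : (2 : k) ≠ 0) {n : ℕ} {φ : SAd k →ₗ[k] k}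
    (hφ : brackets k n ≤ LinearMap.ker φ) : IsInv n fun i l j => φ (mon k i l j) := by
  have hE := fun i l j (h : i + l + j = n) => hφ (slE_lie_mem_brackets (mon_mem' (k := k) h))
  have hH := fun i l j (h : i + l + j = n) => hφ (slH_lie_mem_brackets (mon_mem' (k := k) h))
  have hF := fun i l j (h : i + l + j = n) => hφ (slF_lie_mem_brackets (mon_mem' (k := k) h))
  simp only [LinearMap.mem_ker, slE_lie_mon, slH_lie_mon, slF_lie_mon, map_sub, map_smul,
    smul_eq_mul] at hE hH hF
  refine ⟨fun i l j h => ?_, fun i l j h => ?_, fun i j h => ?_, fun i l h => ?_, fun l j h => ?_⟩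
  · have := hH i l j h
    rw [mul_assoc] at this
    exact (mul_eq_zero.1 this).resolve_left h2
  · have := hE i (l + 1) (j + 1) (by omega)
    simp only [Nat.add_sub_cancel] at this
    push_cast at this
    linear_combination this
  · have := hE i 0 (j + 1) (by omega)
    simpa using this
  · have := hE i (l + 1) 0 (by omega)
    simp only [Nat.add_sub_cancel, Nat.cast_zero, zero_mul, zero_sub, neg_eq_zero] at this
    rw [mul_assoc] at this
    exact_mod_cast (mul_eq_zero.1 this).resolve_left h2
  · have := hF 0 (l + 1) j (by omega)
    simp only [Nat.add_sub_cancel, Nat.cast_zero, zero_mul, sub_zero] at this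
    rw [mul_assoc] at this
    exact_mod_cast (mul_eq_zero.1 this).resolve_left h2

/-- The brackets with f on monomials containing e are not among the listed conditions; they follow
from those for e by trading i for j through the weight condition. -/
theorem IsInv.brackets_le_ker {n : ℕ} {ν : ℕ → ℕ → ℕ → k} (hν : IsInv n ν) {φ : SAd k →ₗ[k] k}
    (hφ : ∀ i l j, φ (mon k i l j) = ν i l j) : brackets k n ≤ LinearMap.ker φ := by
  refine sup_le (sup_le ?_ ?_) ?_ <;> rw [Submodule.map_le_iff_le_comap] <;> intro s hs <;>
    refine symPow_le_of_mon (fun i l j h => ?_) hs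
  · change φ ⁅slE k, mon k i l j⁆ = 0
    rw [slE_lie_mon, map_sub, map_smul, map_smul, hφ, hφ, smul_eq_mul, smul_eq_mul]
    rcases l with _ | l <;> rcases j with _ | j
    · simp
    · have := hν.one i j (by omega)
      simpa using this
    · have := hν.left i l (by omega)
      simp only [Nat.add_sub_cancel]
      push_cast
      linear_combination -2 * this
    · have := hν.step i l j (by omega)
      simp only [Nat.add_sub_cancel]
      push_cast
      linear_combination this
  · change φ ⁅slH k, mon k i l j⁆ = 0
    rw [slH_lie_mon, map_smul, hφ, smul_eq_mul, mul_assoc, hν.weight i l j h, mul_zero]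
  · change φ ⁅slF k, mon k i l j⁆ = 0
    rw [slF_lie_mon, map_sub, map_smul, map_smul, hφ, hφ, smul_eq_mul, smul_eq_mul]
    rcases l with _ | l <;> rcases i with _ | i
    · simp
    · have := hν.one i j (by omega)
      have hw := hν.weight i 1 j (by omega)
      simp only [Nat.add_sub_cancel]
      push_cast
      linear_combination -this - hw
    · have := hν.right l j (by omega)
      simp only [Nat.add_sub_cancel]
      push_cast
      linear_combination 2 * this
    · have := hν.step i l j (by omega)
      have hw := hν.weight i (l + 2) j (by omega)
      simp only [Nat.add_sub_cancel]
      push_cast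
      rw [show l + 1 + 1 = l + 2 from rfl]
      linear_combination -this - hw

variable (p : ℕ) [CharP k p]

/-- If s were outside 𝔤Sᵐ, some functional φ killing 𝔤Sᵐ would have φ(s) ≠ 0. Lifting φ through c to
ψ killing 𝔤Sᵐ⁺² gives φ(s) = ψ(cs) = 0. -/
theorem mem_brackets_of_casimir_mul_mem (hp : 2 < p) {m : ℕ} (hmp : m + 2 ≠ p - 1) {s : SAd k}
    (hs : s ∈ symPow k (slTwo k) (slTwo k) m) (hc : casimir k * s ∈ brackets k (m + 2)) :
    s ∈ brackets k m := by
  by_contra hsm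
  have h2 : (2 : k) ≠ 0 := two_ne_zero_of_charP p hp
  have hprime : p.Prime := (CharP.char_is_prime_or_zero k p).resolve_right (by omega)
  obtain ⟨φ, hφs, hφ⟩ := Submodule.exists_le_ker_of_notMem hsm
  have hinv := isInv_of_brackets_le_ker h2 hφ
  obtain ⟨ν, hν, hlift⟩ : ∃ ν : ℕ → ℕ → ℕ → k, IsInv (m + 2) ν ∧ ∀ i l j, i + l + j = m →
      ν i (l + 2) j + 4 * ν (i + 1) l (j + 1) = φ (mon k i l j) := by
    by_cases hm : (m + 3 : k) = 0
    · exact hinv.exists_lift_of_eq_zero hm p hprime hp h2 (by omega)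
    · exact hinv.exists_lift_of_ne_zero h2 hm
  obtain ⟨ψ, hψ⟩ := exists_linearMap_mon (k := k) (V := k) ν
  have h1 : s ∈ LinearMap.ker (ψ ∘ₗ LinearMap.mulLeft k (casimir k) - φ) := by
    refine symPow_le_of_mon (fun i l j h => ?_) hs
    rw [LinearMap.mem_ker, LinearMap.sub_apply, LinearMap.comp_apply, LinearMap.mulLeft_apply,
      casimir_mul_mon, map_add, map_smul, hψ, hψ, smul_eq_mul, hlift i l j h, sub_self]
  rw [LinearMap.mem_ker, LinearMap.sub_apply, LinearMap.comp_apply, LinearMap.mulLeft_apply,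
    LinearMap.mem_ker.1 (hν.brackets_le_ker hψ hc), zero_sub, neg_eq_zero] at h1
  exact hφs h1

/-- The diagonal invariant functional takes the value 1 at hᵖ⁻³. -/
theorem mon_notMem_brackets (hp : 2 < p) : mon k 0 (p - 3) 0 ∉ brackets k (p - 3) := by
  intro h
  have h2 : (2 : k) ≠ 0 := two_ne_zero_of_charP p hp
  have hprime : p.Prime := (CharP.char_is_prime_or_zero k p).resolve_right (by omega)
  obtain ⟨φ, hφ⟩ := exists_linearMap_mon (k := k) (V := k)
    (fun i _ j => if i = j then ((-4 : k) ^ j * (j + 1))⁻¹ else 0)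
  have h1 := LinearMap.mem_ker.1 ((isInv_diag p hprime hp h2).brackets_le_ker hφ h)
  rw [hφ] at h1
  simp at h1

/-- chᵖ⁻³ = hᵖ⁻¹ + 4ehᵖ⁻³f = [e, hᵖ⁻²f], because -2(p - 2) = 4 in k. -/
theorem casimir_mul_mon_mem_brackets (hp : 2 < p) :
    casimir k * mon k 0 (p - 3) 0 ∈ brackets k (p - 3 + 2) := by
  have h := slE_lie_mem_brackets (mon_mem' (k := k) (show 0 + (p - 3 + 1) + 1 = p - 3 + 2 by omega))
  rw [slE_lie_mon] at h
  have h3 : ((p - 3 + 1 : ℕ) : k) = -2 := by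
    have h4 : ((p - 3 + 1 + 2 : ℕ) : k) = 0 := by
      rw [show p - 3 + 1 + 2 = p by omega, CharP.cast_eq_zero]
    rw [Nat.cast_add _ 2] at h4
    exact eq_neg_of_add_eq_zero_left h4
  rw [casimir_mul_mon]
  rw [h3] at h
  convert h using 1
  simp only [Nat.add_sub_cancel, Nat.cast_one, one_smul, zero_add]
  rw [sub_eq_add_neg, ← neg_smul]
  congr 2
  norm_num

/-- In degree p - 3 a monomial with i ≠ j has nonzero weight modulo p, so it is a multiple of its
bracket with h. The brackets [e, eⁱhˡ⁺¹fⁱ⁺¹] reduce the diagonal monomials to hᵖ⁻³, the coefficients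
2(l + 1) being invertible. -/
theorem symPow_le_brackets_sup_span (hp : 2 < p) {s : SAd k}
    (hs : s ∈ symPow k (slTwo k) (slTwo k) (p - 3)) :
    s ∈ brackets k (p - 3) ⊔ Submodule.span k {mon k 0 (p - 3) 0} := by
  have h2 : (2 : k) ≠ 0 := two_ne_zero_of_charP p hp
  have hprime : p.Prime := (CharP.char_is_prime_or_zero k p).resolve_right (by omega)
  have hne : ∀ j : ℕ, j + 1 < p → ((j + 1 : ℕ) : k) ≠ 0 := by
    intro j hj h'
    rw [CharP.cast_eq_zero_iff k p] at h'
    exact absurd (Nat.le_of_dvd (by omega) h') (by omega)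
  refine symPow_le_of_mon (fun i l j h => ?_) hs
  have hsmul : ∀ (r : k) (t : SAd k), r ≠ 0 →
      r • t ∈ brackets k (p - 3) ⊔ Submodule.span k {mon k 0 (p - 3) 0} →
      t ∈ brackets k (p - 3) ⊔ Submodule.span k {mon k 0 (p - 3) 0} := fun r t hr ht =>
    (Submodule.smul_mem_iff _ hr).1 ht
  by_cases hij : i = j
  · subst hij
    induction i generalizing l with
    | zero =>
      obtain rfl : l = p - 3 := by omega
      exact Submodule.mem_sup_right (Submodule.mem_span_singleton_self _)
    | succ i ih =>
      have h1 := ih (l + 2) (by omega)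
      have h3 := Submodule.mem_sup_left (T := Submodule.span k {mon k 0 (p - 3) 0})
        (slE_lie_mem_brackets (mon_mem' (k := k) (show i + (l + 1) + (i + 1) = p - 3 by omega)))
      rw [slE_lie_mon] at h3
      have h4 := Submodule.sub_mem _ (Submodule.smul_mem _ ((i + 1 : ℕ) : k) h1) h3
      simp only [Nat.add_sub_cancel] at h4
      rw [show l + 1 + 1 = l + 2 from rfl, sub_sub_cancel] at h4
      exact hsmul _ _ (mul_ne_zero h2 (hne l (by omega))) h4
  · refine Submodule.mem_sup_left ?_
    have h1 := slH_lie_mem_brackets (mon_mem' (k := k) h)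
    rw [slH_lie_mon] at h1
    refine (Submodule.smul_mem_iff _ (mul_ne_zero h2 (sub_ne_zero.2 fun h3 => hij ?_))).1 h1
    rw [CharP.natCast_eq_natCast k p] at h3
    exact Nat.ModEq.eq_of_lt_of_lt h3 (by omega) (by omega)

end Coinvariants

/-! ### Exactness of 0 → Sⁿ⁻² → Sⁿ → S²ⁿ(L(1)) → 0 -/

section ShortExactSequence

variable {k : Type u} [Field k]

/-- The symmetric algebra is a domain, and c ≠ 0 because its coefficient at h² is 1. -/
theorem mulCasimir_injective (n : ℕ) (hn : 2 ≤ n) :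
    Function.Injective (mulCasimir (k := k) n hn) := by
  have hc : casimir k ≠ 0 := by
    intro h
    obtain ⟨φ, hφ⟩ := exists_linearMap_mon (k := k) (V := k) fun i l j => if i = 0 ∧ l = 2 ∧ j = 0 then (1 : k) else 0
    have h1 := casimir_mul_mon (k := k) 0 0 0
    have h3 := congrArg φ h1
    rw [h, zero_mul, map_zero, map_add, map_smul, hφ, hφ] at h3
    simp at h3
  intro s t h
  exact Subtype.ext (mul_left_cancel₀ hc (congrArg Subtype.val h))

theorem phiAlg_mon (i l j : ℕ) :
    phiAlg k (mon k i l j) =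
      ((-(1 / 2)) ^ i * (1 / 2) ^ j : k) • (natX k ^ (2 * i + l) * natY k ^ (2 * j + l)) := by
  have he : phiAlg k (SymAlg.ι k _ (slE k)) = (-(1 / 2) : k) • natX k ^ 2 := by
    simp [phiAlg, phiLin, slE, neg_div]
  have hh : phiAlg k (SymAlg.ι k _ (slH k)) = natX k * natY k := by
    simp [phiAlg, phiLin, slH]
  have hf : phiAlg k (SymAlg.ι k _ (slF k)) = (1 / 2 : k) • natY k ^ 2 := by
    simp [phiAlg, phiLin, slF]
  rw [mon, map_mul, map_mul, map_pow, map_pow, map_pow, he, hh, hf]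
  simp only [Algebra.smul_def, map_mul, map_pow]
  ring

/-- A linear section of `φ : Sⁿ → S²ⁿ(L(1))`, whose values are well defined modulo the image of
multiplication by the Casimir element. -/
theorem exists_phi_section (h2 : (2 : k) ≠ 0) (n : ℕ) :
    ∃ σ : SNat k →ₗ[k] SAd k,
      (∀ t ∈ symPow k (NatRep k) (slTwo k) (2 * n),
        σ t ∈ symPow k (slTwo k) (slTwo k) n ∧ phiAlg k (σ t) = t) ∧
      ∀ i l j, i + l + j = n → (i = 0 ∨ j = 0) → σ (phiAlg k (mon k i l j)) = mon k i l j := by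
  have hh : (1 / 2 : k) ≠ 0 := one_div_ne_zero h2
  -- For a + b = 2n the halves are exact: xᵃyᵇ is lifted to a multiple of hᵃf⁽ᵇ⁻ᵃ⁾ᐟ² if a ≤ b, and
  -- of e⁽ᵃ⁻ᵇ⁾ᐟ²hᵇ otherwise.
  obtain ⟨σ, hσ⟩ := exists_linearMap_nat (k := k) fun a b =>
    if a ≤ b then ((1 / 2 : k) ^ ((b - a) / 2))⁻¹ • mon k 0 a ((b - a) / 2)
    else ((-(1 / 2) : k) ^ ((a - b) / 2))⁻¹ • mon k ((a - b) / 2) b 0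
  have hmon : ∀ i l j, (i = 0 ∨ j = 0) → σ (phiAlg k (mon k i l j)) = mon k i l j := by
    intro i l j hij
    rw [phiAlg_mon, map_smul, hσ]
    rcases Nat.eq_zero_or_pos i with rfl | hi
    · rw [if_pos (by omega), show (2 * j + l - (2 * 0 + l)) / 2 = j by omega, smul_smul,
        pow_zero, one_mul, mul_inv_cancel₀ (pow_ne_zero _ hh), one_smul, mul_zero, zero_add]
    · obtain rfl : j = 0 := by omega
      rw [if_neg (by omega), show (2 * i + l - (2 * 0 + l)) / 2 = i by omega, smul_smul,
        pow_zero, mul_one, mul_inv_cancel₀ (pow_ne_zero _ (neg_ne_zero.2 hh)), one_smul, mul_zero,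
        zero_add]
  refine ⟨σ, fun t ht => ?_, fun i l j _ => hmon i l j⟩
  have key : t ∈ (symPow k (slTwo k) (slTwo k) n).toSubmodule.comap σ ⊓
      LinearMap.ker ((phiAlg k).toLinearMap ∘ₗ σ - LinearMap.id) := by
    refine symPow_nat_le (fun a b hab => ?_) ht
    rw [Submodule.mem_inf, Submodule.mem_comap, LinearMap.mem_ker, LinearMap.sub_apply,
      LinearMap.comp_apply, hσ, sub_eq_zero]
    split_ifs with h
    · refine ⟨Submodule.smul_mem _ _ (mon_mem' (by omega)), ?_⟩
      rw [AlgHom.toLinearMap_apply, map_smul, phiAlg_mon, smul_smul, pow_zero, one_mul,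
        inv_mul_cancel₀ (pow_ne_zero _ hh), one_smul, mul_zero, zero_add,
        show 2 * ((b - a) / 2) + a = b by omega]
      rfl
    · refine ⟨Submodule.smul_mem _ _ (mon_mem' (by omega)), ?_⟩
      rw [AlgHom.toLinearMap_apply, map_smul, phiAlg_mon, smul_smul, pow_zero, mul_one,
        inv_mul_cancel₀ (pow_ne_zero _ (neg_ne_zero.2 hh)), one_smul, mul_zero, zero_add,
        show 2 * ((a - b) / 2) + b = a by omega]
      rfl
  rw [Submodule.mem_inf, LinearMap.mem_ker, LinearMap.sub_apply, sub_eq_zero] at key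
  exact key

/-- Modulo cSⁿ⁻² one may replace ef by -h²/4, which reduces every monomial to one without e or
without f, and these are fixed by σφ. Hence s - σφ(s) always lies in cSⁿ⁻². -/
theorem exists_eq_casimir_mul (h2 : (2 : k) ≠ 0) {n : ℕ} (hn : 2 ≤ n) {s : SAd k}
    (hs : s ∈ symPow k (slTwo k) (slTwo k) n) (h0 : phiAlg k s = 0) :
    ∃ t ∈ symPow k (slTwo k) (slTwo k) (n - 2), casimir k * t = s := by
  have h4 : (4 : k) ≠ 0 := by
    convert mul_ne_zero h2 h2 using 1
    norm_num
  obtain ⟨σ, -, hσ⟩ := exists_phi_section h2 n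
  let V := (symPow k (slTwo k) (slTwo k) (n - 2)).toSubmodule.map
    (LinearMap.mulLeft k (casimir k))
  have key : s ∈ V.comap (LinearMap.id - σ ∘ₗ (phiAlg k).toLinearMap) := by
    refine symPow_le_of_mon (fun i l j h => ?_) hs
    rw [Submodule.mem_comap, LinearMap.sub_apply, LinearMap.id_apply, LinearMap.comp_apply,
      AlgHom.toLinearMap_apply]
    induction i generalizing l j with
    | zero => rw [hσ 0 l j h (Or.inl rfl), sub_self]; exact V.zero_mem
    | succ i ih =>
      rcases j with _ | j
      · rw [hσ (i + 1) l 0 h (Or.inr rfl), sub_self]; exact V.zero_mem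
      · have h1 := ih (l + 2) j (by omega)
        have h3 : casimir k * mon k i l j ∈ V :=
          Submodule.mem_map_of_mem (mon_mem' (k := k) (show i + l + j = n - 2 by omega))
        have h5 := casimir_mul_mon (k := k) i l j
        have h6 : mon k (i + 1) l (j + 1) =
            (4 : k)⁻¹ • (casimir k * mon k i l j - mon k i (l + 2) j) := by
          rw [h5, add_sub_cancel_left, smul_smul, inv_mul_cancel₀ h4, one_smul]
        have h7 : mon k (i + 1) l (j + 1) - σ (phiAlg k (mon k (i + 1) l (j + 1))) =
            (4 : k)⁻¹ • (casimir k * mon k i l j -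
              (mon k i (l + 2) j - σ (phiAlg k (mon k i (l + 2) j)))) := by
          rw [h6]
          simp only [map_smul, map_sub, map_mul, phiAlg_casimir h2, zero_mul, zero_sub, map_neg]
          module
        rw [h7]
        exact V.smul_mem _ (V.sub_mem h3 h1)
  rw [Submodule.mem_comap, LinearMap.sub_apply, LinearMap.id_apply, LinearMap.comp_apply,
    AlgHom.toLinearMap_apply, h0, map_zero, sub_zero] at key
  exact key

theorem sesSym_shortExact (h2 : (2 : k) ≠ 0) (n : ℕ) (hn : 2 ≤ n) :
    (sesSym h2 n hn).ShortExact := by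
  refine ModuleCat.shortComplex_shortExact _ ?_ ?_ ?_
  · intro s
    constructor
    · intro h
      obtain ⟨t, ht, hts⟩ := exists_eq_casimir_mul h2 hn s.2 (congrArg Subtype.val h)
      exact ⟨⟨t, ht⟩, Subtype.ext hts⟩
    · rintro ⟨t, rfl⟩
      refine Subtype.ext ?_
      change phiAlg k (casimir k * t.1) = 0
      rw [map_mul, phiAlg_casimir h2, zero_mul]
  · exact mulCasimir_injective n hn
  · intro t
    obtain ⟨σ, hσ, -⟩ := exists_phi_section h2 n
    exact ⟨⟨σ t.1, (hσ t.1 t.2).1⟩, Subtype.ext (hσ t.1 t.2).2⟩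

end ShortExactSequence

/-! ### The image of the connecting homomorphism -/

section ConnectingHom

variable {k : Type u} [Field k]

theorem extThree_symPow_eq_zero_iff {n : ℕ} (s : symPow k (slTwo k) (slTwo k) n) :
    (extThree _ s : Ext (trivialModule k) (uModule k (slTwo k) (symPow k (slTwo k) (slTwo k) n)) 3)
      = 0 ↔ s.1 ∈ brackets k n :=
  (extThree_eq_zero_iff s).trans (mem_brackets_iff s).symm

/-- The image of the connecting homomorphism consists of the classes of the elements that
multiplication by the Casimir element takes to `𝔤Sⁿ`. -/
theorem extThree_mem_range_connectingHom_iff {h2 : (2 : k) ≠ 0} {n : ℕ} {hn : 2 ≤ n}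
    (hS : (sesSym h2 n hn).ShortExact) (s : symPow k (slTwo k) (slTwo k) (n - 2)) :
    (extThree _ s : Ext (trivialModule k) _ 3) ∈
        LinearMap.range (connectingHom k (trivialModule k) hS 2) ↔
      casimir k * s.1 ∈ brackets k n := by
  have h1 := extThree_comp (mulCasimir n hn) s
  have h3 := extThree_symPow_eq_zero_iff (mulCasimir n hn s)
  change _ ↔ (mulCasimir n hn s).1 ∈ brackets k n
  rw [← h3, ← h1]
  constructor
  · rintro ⟨x, hx⟩
    rw [← hx]
    refine (Ext.comp_assoc_of_third_deg_zero x hS.extClass (Ext.mk₀ (sesSym h2 n hn).f)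
      (rfl : 2 + 1 = 3)).trans ?_
    rw [hS.extClass_comp, Ext.comp_zero]
    rfl
  · intro h
    obtain ⟨x, hx⟩ := Ext.covariant_sequence_exact₁ (trivialModule k) hS
      (extThree _ s : Ext (trivialModule k) _ 3) h (rfl : 2 + 1 = 3)
    exact ⟨x, hx⟩

variable (p : ℕ) [CharP k p]

theorem connectingHom_eq_zero (hp : 2 < p) {h2 : (2 : k) ≠ 0} {n : ℕ} {hn : 2 ≤ n}
    (hS : (sesSym h2 n hn).ShortExact) (hnp : n ≠ p - 1) :
    connectingHom k (trivialModule k) hS 2 = 0 := by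
  refine LinearMap.ext fun x => ?_
  obtain ⟨s, hs⟩ := extThree_surjective (connectingHom k (trivialModule k) hS 2 x)
  have h := (extThree_mem_range_connectingHom_iff hS s).1 ⟨x, hs.symm⟩
  rw [← hs]
  refine (extThree_symPow_eq_zero_iff s).2 (mem_brackets_of_casimir_mul_mem p hp ?_ s.2 ?_)
  · rwa [Nat.sub_add_cancel hn]
  · rwa [Nat.sub_add_cancel hn]

theorem finrank_range_connectingHom (hp : 2 < p) {h2 : (2 : k) ≠ 0} {n : ℕ} {hn : 2 ≤ n}
    (hS : (sesSym h2 n hn).ShortExact) (hnp : n = p - 1) :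
    Module.finrank k (LinearMap.range (connectingHom k (trivialModule k) hS 2)) = 1 := by
  have hm : p - 3 = n - 2 := by omega
  let s₀ : symPow k (slTwo k) (slTwo k) (n - 2) := ⟨mon k 0 (p - 3) 0, mon_mem' (by omega)⟩
  let z : Ext (trivialModule k) (sesSym h2 n hn).X₁ 3 := extThree _ s₀
  have hz : z ≠ 0 := fun h => by
    have h' : mon k 0 (p - 3) 0 ∈ brackets k (n - 2) := (extThree_symPow_eq_zero_iff s₀).1 h
    rw [← hm] at h'
    exact mon_notMem_brackets p hp h'
  have hrange : LinearMap.range (connectingHom k (trivialModule k) hS 2) = Submodule.span k {z} := by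
    apply le_antisymm
    -- All of Ext³(k, Sᵖ⁻³) is spanned by z, since the coinvariants are spanned by the class of
    -- hᵖ⁻³.
    · intro y _
      obtain ⟨s, rfl⟩ := extThree_surjective y
      have h1 := symPow_le_brackets_sup_span (s := s.1) p hp (by rw [hm]; exact s.2)
      obtain ⟨b, hb, t, ht, hbt⟩ := Submodule.mem_sup.1 h1
      obtain ⟨r, rfl⟩ := Submodule.mem_span_singleton.1 ht
      refine Submodule.mem_span_singleton.2 ⟨r, ?_⟩
      have h3 : (extThree _ (s - r • s₀) : Ext (trivialModule k) (uModule k (slTwo k) _) 3) = 0 := by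
        rw [extThree_symPow_eq_zero_iff]
        change s.1 - r • mon k 0 (p - 3) 0 ∈ brackets k (n - 2)
        rwa [← hbt, add_sub_cancel_right, ← hm]
      rw [map_sub, map_smul, sub_eq_zero] at h3
      exact h3.symm
    · rw [Submodule.span_singleton_le_iff_mem]
      refine (extThree_mem_range_connectingHom_iff hS s₀).2 ?_
      have h := casimir_mul_mon_mem_brackets (k := k) p hp
      rwa [hm, Nat.sub_add_cancel hn, ← hm] at h
  rw [hrange, finrank_span_singleton hz]

end ConnectingHom

end SlTwoExt

end

/-- Over a field `k` of characteristic `p > 2`, the sequence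
`0 → Sⁿ⁻² → Sⁿ → S²ⁿ(L(1)) → 0` of `U(𝔰𝔩₂(k))`-modules is short exact, and its third connecting
homomorphism `Ext²(k, S²ⁿ(L(1))) → Ext³(k, Sⁿ⁻²)` is zero, except when `n = p - 1`, where its image
is one-dimensional. -/
theorem mainTheorem7 (k : Type*) [Field k] (p : ℕ) [CharP k p] (hp : 2 < p)
    (n : ℕ) (hn : 2 ≤ n) :
    ∃ hS : (SlTwoExt.sesSym (SlTwoExt.two_ne_zero_of_charP (k := k) p hp) n hn).ShortExact,
      (n ≠ p - 1 →
        SlTwoExt.connectingHom k (SlTwoExt.trivialModule k) hS 2 = 0) ∧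
      (n = p - 1 →
        Module.finrank k
          (LinearMap.range (SlTwoExt.connectingHom k (SlTwoExt.trivialModule k) hS 2)) = 1) := by
  have hS := SlTwoExt.sesSym_shortExact (SlTwoExt.two_ne_zero_of_charP (k := k) p hp) n hn
  exact ⟨hS, SlTwoExt.connectingHom_eq_zero p hp hS, SlTwoExt.finrank_range_connectingHom p hp hS⟩
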